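/- An approval election $E=(C,V)$ consists of a finite set $C$ of candidates and a finite collection $V$ of voters, where each voter $v$ approves a set $A(v)\subseteq C$. The SAV score of a candidate $c$ is $\sum_{v\in V:\,c\in A(v)} 1/|A(v)|$, the SAV score of a committee $S\subseteq C$ is the sum of the SAV scores of its members, and for $k\in\{1,\dots,|C|\}$ we let $\mathrm{SAV}(E,k)$ be the family of all size-$k$ committees with the highest SAV score. An Add operation adds an approval for one candidate to one vote in which this candidate is not approved, a Remove operation removes one approval from one vote, and a Swap operation moves one approval, within one vote, from an approved candidate to a candidate that is not approved. For $\mathrm{Op}\in\{\mathrm{Add},\mathrm{Remove},\mathrm{Swap}\}$, the problem SAV-Op-Robustness-Radius is the following: given an approval election $E=(C,V)$ (as the list of candidates and, for each voter, the $0/1$ vector of approvals), a committee size $k\in\{1,\dots,|C|\}$ and a nonnegative integer $B$ (both in binary), decide whether by applying a sequence of at most $B$ operations of type $\mathrm{Op}$ it is possible to obtain an election $E'$ with $\mathrm{SAV}(E,k)\neq \mathrm{SAV}(E',k)$. Theorem. For each $\mathrm{Op}\in\{\mathrm{Add},\mathrm{Remove},\mathrm{Swap}\}$, SAV-Op-Robustness-Radius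 is in $\mathrm{P}$. -/

import Mathlib

/-! ### Approval elections and satisfaction approval voting (SAV) -/

/-- An approval-based election with candidates `Fin m` and voters `Fin n`: the set `E v` consists
of the candidates that voter `v` approves. -/
abbrev Election (m n : ℕ) : Type := Fin n → Finset (Fin m)

/-- A multiwinner voting rule maps an election and a committee size to the family of committees
that tie for victory. -/
abbrev MultiwinnerRule : Type := ∀ m n : ℕ, Election m n → ℕ → Set (Finset (Fin m))

/-- The SAV score of a candidate: each voter has one point and splits it equally among the
candidates that the voter approves. -/
def savCandidateScore {m n : ℕ} (E : Election m n) (c : Fin m) : ℚ :=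
  ∑ v : Fin n with c ∈ E v, 1 / ((E v).card : ℚ)

/-- The SAV score of a committee. -/
def savScore {m n : ℕ} (E : Election m n) (S : Finset (Fin m)) : ℚ :=
  ∑ c ∈ S, savCandidateScore E c

/-- The SAV rule: all committees of size `k` with the highest SAV score. -/
def savRule : MultiwinnerRule := fun m _ E k =>
  {S : Finset (Fin m) | S.card = k ∧ ∀ T : Finset (Fin m), T.card = k → savScore E T ≤ savScore E S}

/-! ### Operations on approvals and the robustness radius problem -/

/-- The three types of operations. -/
inductive ApprovalOp : Type
  | add
  | remove
  | swap

/-- `op.Step E E'`: the election `E'` arises from `E` by a single operation of type `op`, which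
adds an approval to a vote, removes an approval from a vote, or moves an approval, within a vote,
from an approved candidate to one that is not approved. -/
def ApprovalOp.Step {m n : ℕ} : ApprovalOp → Election m n → Election m n → Prop
  | .add, E, E' => ∃ v c, c ∉ E v ∧ E' = Function.update E v (insert c (E v))
  | .remove, E, E' => ∃ v c, c ∈ E v ∧ E' = Function.update E v ((E v).erase c)
  | .swap, E, E' => ∃ v c d, c ∈ E v ∧ d ∉ E v ∧
      E' = Function.update E v (insert d ((E v).erase c))

/-- `op.Steps j E E'`: the election `E'` arises from `E` by a sequence of exactly `j` operations
of type `op`. -/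
def ApprovalOp.Steps {m n : ℕ} (op : ApprovalOp) : ℕ → Election m n → Election m n → Prop
  | 0, E, E' => E' = E
  | j + 1, E, E' => ∃ F, op.Step E F ∧ op.Steps j F E'

/-- An instance of the robustness radius problem: an election, a committee size between `1` and
the number of candidates, and a bound on the number of operations. -/
structure RadiusInstance : Type where
  m : ℕ
  n : ℕ
  election : Election m n
  k : ℕ
  bound : ℕ
  one_le_k : 1 ≤ k
  k_le_m : k ≤ m

/-- The question of the problem: can the result of the election under the rule `R` be changed by
performing at most `bound` operations of type `op`? -/
def RadiusInstance.IsYes (R : MultiwinnerRule) (op : ApprovalOp) (I : RadiusInstance) : Prop :=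
  ∃ j ≤ I.bound, ∃ E' : Election I.m I.n,
    op.Steps j I.election E' ∧ R I.m I.n I.election I.k ≠ R I.m I.n E' I.k

/-! ### Encoding of instances as words

Words are over the three-letter alphabet `Option Bool`: the two bits and the separator `none`. -/

/-- A block of bits, closed by a separator. -/
def bitBlock (l : List Bool) : List (Option Bool) := l.map some ++ [none]

/-- The code of an instance consists of the list of candidates (`m` letters), the committee size
and the bound in binary (least significant bit first), and the ballots of the voters, one row of
`m` approval bits for each voter. -/
def RadiusInstance.encode (I : RadiusInstance) : List (Option Bool) :=
  bitBlock (List.replicate I.m true) ++ bitBlock I.k.bits ++ bitBlock I.bound.bits ++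
    (List.ofFn fun v : Fin I.n =>
      bitBlock (List.ofFn fun c : Fin I.m => decide (c ∈ I.election v))).flatten

/-- The decision problem `R`-`op`-Robustness-Radius as a language: the codes of its
yes-instances. -/
def robustnessRadius (R : MultiwinnerRule) (op : ApprovalOp) : Language (Option Bool) :=
  {w | ∃ I : RadiusInstance, I.encode = w ∧ I.IsYes R op}

/-! ### The class P -/

open Classical in
/-- A language is in P if its characteristic function on the set of all words is computed by a
(multi-stack) Turing machine in time polynomial in the length of the word. -/
def InP {Γ : Type} (L : Language Γ) : Prop :=
  Nonempty (Turing.TM2ComputableInPolyTime (id : List Γ → List Γ) Computability.encodeBool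
    (fun w : List Γ => decide (w ∈ L)))

/-! ### Different instances have different codes -/

theorem bitBlock_append_inj {a b : List Bool} {s t : List (Option Bool)}
    (h : bitBlock a ++ s = bitBlock b ++ t) : a = b ∧ s = t := by
  induction a generalizing b with
  | nil => cases b <;> simp_all [bitBlock]
  | cons x a ih =>
    cases b with
    | nil => simp [bitBlock] at h
    | cons y b =>
      have h' : x = y ∧ bitBlock a ++ s = bitBlock b ++ t := by simpa [bitBlock] using h
      obtain ⟨h1, h2⟩ := ih h'.2
      exact ⟨by rw [h'.1, h1], h2⟩

theorem flatten_bitBlock_inj {a b : List (List Bool)}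
    (h : (a.map bitBlock).flatten = (b.map bitBlock).flatten) : a = b := by
  induction a generalizing b with
  | nil => cases b <;> simp_all [bitBlock]
  | cons x a ih =>
    cases b with
    | nil => simp [bitBlock] at h
    | cons y b =>
      rw [List.map_cons, List.map_cons, List.flatten_cons, List.flatten_cons] at h
      obtain ⟨h1, h2⟩ := bitBlock_append_inj h
      rw [h1, ih h2]

theorem natBits_inj {a b : ℕ} (h : a.bits = b.bits) : a = b := by
  apply Nat.eq_of_testBit_eq
  intro i
  rw [Nat.testBit_eq_inth, Nat.testBit_eq_inth, h]

theorem RadiusInstance.encode_injective : Function.Injective RadiusInstance.encode := by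
  rintro ⟨m, n, E, k, B, h1, h2⟩ ⟨m', n', E', k', B', h1', h2'⟩ h
  simp only [RadiusInstance.encode, List.append_assoc] at h
  obtain ⟨hm, h⟩ := bitBlock_append_inj h
  obtain ⟨hk, h⟩ := bitBlock_append_inj h
  obtain ⟨hB, h⟩ := bitBlock_append_inj h
  have hm' : m = m' := by simpa using congrArg List.length hm
  subst hm'
  obtain rfl := natBits_inj hk
  obtain rfl := natBits_inj hB
  have h' : (List.ofFn fun v : Fin n => List.ofFn fun c : Fin m => decide (c ∈ E v)) =
      (List.ofFn fun v : Fin n' => List.ofFn fun c : Fin m => decide (c ∈ E' v)) := by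
    apply flatten_bitBlock_inj
    simpa [List.map_ofFn, Function.comp_def] using h
  have hn : n = n' := by simpa using congrArg List.length h'
  subst hn
  have hE : E = E' := by
    funext v
    have h3 := congrFun (List.ofFn_injective h') v
    ext c
    simpa using congrFun (List.ofFn_injective h3) c
  subst hE
  rfl

/-!
The theorem is proved by an explicit algorithm, a dynamic program over the voters, together with a
small theory of polynomial-time functions on top of multi-stack Turing machines.

**The algorithm.** Exchanging single candidates shows that the family of winning committees changes
if and only if there are candidates `a ≠ b` such that some winning committee contains `b` but not
`a` and, after the operations, `a` has a higher score than `b`, or at least the same score although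
it was behind in the beginning (`winners_ne_iff`). That a winning committee separates `b` from `a`
is a condition on the numbers of candidates above `b` and not below `a` (`exists_winner_iff`). For
fixed `a` and `b`, each voter contributes separately to the difference of the two scores, and for
each type of operation only few ways to treat a ballot are sensible: with additions and swaps, a
single operation is best; with removals, a voter who approves `a` should keep that approval and
lose the one of `b` first. These are the `options` of a voter, and
`exists_ballot_of_mem_options` and `exists_option_of_ballotSteps` say that they are possible and
sufficient. Choosing one option for each voter so that the total gain is maximal for each total
cost is a knapsack problem with polynomially many costs, since no voter needs more operations than
there are candidates; `table` solves it. All scores are multiples of `1 / m!`, so that the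
computation uses natural numbers with polynomially many bits. Adding the original share of `b` to
each option makes all numbers nonnegative: the total is then to be compared with the original score
of `b`.

**Polynomial time.** Data are binary trees, stored in prefix notation on one stack; two further
stacks hold trees temporarily, and a fourth one counts subtrees while a tree is moved. Structured
programs on these stacks are translated into Turing machines step by step (`Run.simulate`,
`inP_of_run`). A function between encoded types is `PolyTime` if such a program computes it in a
number of steps bounded by a polynomial in the size of the tree. This class is closed under
composition, pairing, case distinction, and iteration over lists as long as the intermediate results
have polynomially bounded size (`PolyTime.foldl`). Binary arithmetic and the usual list functions
follow, and then the algorithm (`PolyTime.decideWord`) is assembled from them by `fun_prop`.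
-/

namespace SavRobustness

open Turing

/-! ### Structured programs on four stacks, and their translation to Turing machines -/

/-- Tokens on the stacks: `some true` opens a pair, `some false` is the empty tree and `none` is a
mark that delimits regions of a stack. -/
abbrev Tok : Type := Option Bool

/-- The contents of the four stacks. -/
abbrev Stacks : Type := Fin 4 → List Tok

/-- Structured programs. `case k f` pops stack `k` and goes on with `f` of the symbol found (`none`
for the empty stack). `loop k quit body` pops stack `k`; if the symbol satisfies `quit`, then it
ends, and otherwise it runs `body` of the symbol and starts again. -/
inductive Prog : Type
  | skip : Prog
  | push (k : Fin 4) (t : Tok) : Prog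
  | seq (p q : Prog) : Prog
  | case (k : Fin 4) (f : Option Tok → Prog) : Prog
  | loop (k : Fin 4) (quit : Option Tok → Bool) (body : Option Tok → Prog) : Prog

/-- `Run p s s' t`: started on the stacks `s`, the program `p` ends with the stacks `s'` after
exactly `t` steps. -/
inductive Run : Prog → Stacks → Stacks → ℕ → Prop
  | skip (s : Stacks) : Run .skip s s 1
  | push (k : Fin 4) (x : Tok) (s : Stacks) :
      Run (.push k x) s (Function.update s k (x :: s k)) 1
  | seq {p q : Prog} {s s' s'' : Stacks} {t t' : ℕ} :
      Run p s s' t → Run q s' s'' t' → Run (.seq p q) s s'' (t + t')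
  | case {k : Fin 4} {f : Option Tok → Prog} {s s' : Stacks} {t : ℕ} :
      Run (f (s k).head?) (Function.update s k (s k).tail) s' t → Run (.case k f) s s' (1 + t)
  | loop_exit {k : Fin 4} {quit : Option Tok → Bool} {body : Option Tok → Prog} {s : Stacks} :
      quit (s k).head? = true → Run (.loop k quit body) s (Function.update s k (s k).tail) 1
  | loop_step {k : Fin 4} {quit : Option Tok → Bool} {body : Option Tok → Prog}
      {s s' s'' : Stacks} {t t' : ℕ} :
      quit (s k).head? = false →
      Run (body (s k).head?) (Function.update s k (s k).tail) s' t →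
      Run (.loop k quit body) s' s'' t' → Run (.loop k quit body) s s'' (1 + t + t')

/-- The program points of a program: the labels of the machine that runs it. -/
def Prog.Label : Prog → Type
  | .skip => Unit
  | .push _ _ => Unit
  | .seq p q => p.Label ⊕ q.Label
  | .case _ f => Option (Σ o, (f o).Label)
  | .loop _ _ body => Option (Σ o, (body o).Label)

/-- The program point where a program starts. -/
def Prog.start : (p : Prog) → p.Label
  | .skip => ()
  | .push _ _ => ()
  | .seq p _ => Sum.inl p.start
  | .case _ _ => none
  | .loop _ _ _ => none

theorem Prog.finite_label (p : Prog) : Finite p.Label := by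
  induction p with
  | skip => exact inferInstanceAs (Finite Unit)
  | push => exact inferInstanceAs (Finite Unit)
  | seq p q hp hq =>
    have := hp
    have := hq
    exact inferInstanceAs (Finite (p.Label ⊕ q.Label))
  | case k f hf =>
    have := hf
    exact inferInstanceAs (Finite (Option (Σ o, (f o).Label)))
  | loop k quit f hf =>
    have := hf
    exact inferInstanceAs (Finite (Option (Σ o, (f o).Label)))

/-- The stack alphabets of the machine: the four stacks of a program hold tokens, and one further
stack receives the answer. -/
abbrev StackAlphabet : Option (Fin 4) → Type
  | none => Bool
  | some _ => Tok

/-- The stacks of a program as the stacks of a machine whose answer stack is empty. -/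
def Stacks.extend (s : Stacks) : ∀ k, List (StackAlphabet k)
  | none => []
  | some k => s k

theorem Stacks.update_extend (s : Stacks) (k : Fin 4) (l : List Tok) :
    Function.update s.extend (some k) l = Stacks.extend (Function.update s k l) := by
  funext j
  cases j with
  | none => simp [Stacks.extend]
  | some j =>
    by_cases h : j = k
    · subst h
      simp [Stacks.extend]
    · simp [Stacks.extend, Function.update_of_ne h,
        Function.update_of_ne (fun h' => h (Option.some.inj h') : some j ≠ some k)]

/-- The statement of the machine at each program point of `p`, when the program points are embedded
into the labels `Λ` of the machine and control passes to the label `exit` at the end of `p`. The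
state of the machine is the symbol popped last. -/
def Prog.code : (p : Prog) → {Λ : Type} → (p.Label → Λ) → Λ → p.Label →
    TM2.Stmt StackAlphabet Λ (Option Tok)
  | .skip, _, _, exit, _ => .goto fun _ => exit
  | .push k x, _, _, exit, _ => .push (some k) (fun _ => x) (.goto fun _ => exit)
  | .seq p q, _, emb, exit, l =>
    match l with
    | .inl l => p.code (fun l => emb (.inl l)) (emb (.inr q.start)) l
    | .inr l => q.code (fun l => emb (.inr l)) exit l
  | .case k f, _, emb, exit, l =>
    match l with
    | none => .pop (some k) (fun _ o => o) (.goto fun o => emb (some ⟨o, (f o).start⟩))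
    | some ⟨o, l⟩ => (f o).code (fun l => emb (some ⟨o, l⟩)) exit l
  | .loop k quit body, _, emb, exit, l =>
    match l with
    | none => .pop (some k) (fun _ o => o)
        (.goto fun o => bif quit o then exit else emb (some ⟨o, (body o).start⟩))
    | some ⟨o, l⟩ => (body o).code (fun l => emb (some ⟨o, l⟩)) (emb none) l

/-- Iterating the step function of a machine. -/
abbrev stepN {Λ : Type} (M : Λ → TM2.Stmt StackAlphabet Λ (Option Tok)) (t : ℕ)
    (c : Option (TM2.Cfg StackAlphabet Λ (Option Tok))) :
    Option (TM2.Cfg StackAlphabet Λ (Option Tok)) :=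
  (flip bind (TM2.step M))^[t] c

/-- A machine that contains the code of `p` simulates the runs of `p` step by step. -/
theorem Run.simulate {p : Prog} {s s' : Stacks} {t : ℕ} (h : Run p s s' t) {Λ : Type}
    (M : Λ → TM2.Stmt StackAlphabet Λ (Option Tok)) (emb : p.Label → Λ) (exit : Λ)
    (hM : ∀ l, M (emb l) = p.code emb exit l) (v : Option Tok) :
    ∃ v', stepN M t (some ⟨some (emb p.start), v, s.extend⟩) =
      some ⟨some exit, v', s'.extend⟩ := by
  induction h generalizing Λ v with
  | skip s =>
    refine ⟨v, ?_⟩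
    have := hM ()
    simp only [Prog.code] at this
    simp [stepN, flip, Prog.start, TM2.step, this, TM2.stepAux]
  | push k x s =>
    refine ⟨v, ?_⟩
    have := hM ()
    simp only [Prog.code] at this
    simp [stepN, flip, Prog.start, TM2.step, this, TM2.stepAux, ← Stacks.update_extend]
    rfl
  | @seq p q s s' s'' t t' hp hq ihp ihq =>
    obtain ⟨v1, h1⟩ := ihp M (fun l => emb (.inl l)) (emb (.inr q.start))
      (fun l => hM (.inl l)) v
    obtain ⟨v2, h2⟩ := ihq M (fun l => emb (.inr l)) exit (fun l => hM (.inr l)) v1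
    refine ⟨v2, ?_⟩
    rw [stepN, Nat.add_comm, Function.iterate_add_apply]
    exact (congrArg _ h1).trans h2
  | @case k f s s' t hf ih =>
    have h0 := hM none
    obtain ⟨v1, h1⟩ := ih M (fun l => emb (some ⟨_, l⟩)) exit
      (fun l => hM (some ⟨_, l⟩)) (s k).head?
    refine ⟨v1, ?_⟩
    rw [stepN, Nat.add_comm, Function.iterate_succ_apply]
    refine Eq.trans (congrArg _ ?_) h1
    simp only [Prog.code] at h0
    rw [← Stacks.update_extend]
    simp only [flip, Prog.start, Option.bind_eq_bind, Option.bind_some, TM2.step]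
    exact (congrArg (fun q => some (TM2.stepAux q v s.extend)) h0)
  | @loop_exit k quit body s hs =>
    have h0 := hM none
    refine ⟨(s k).head?, ?_⟩
    simp only [Prog.code] at h0
    rw [← Stacks.update_extend]
    refine (congrArg (fun q => some (TM2.stepAux q v s.extend)) h0).trans ?_
    simp only [TM2.stepAux]
    have : quit (s.extend (some k)).head? = true := hs
    rw [this]
    rfl
  | @loop_step k quit body s s' s'' t t' hs hb hl ihb ihl =>
    have h0 := hM none
    obtain ⟨v1, h1⟩ := ihb M (fun l => emb (some ⟨_, l⟩)) (emb none)
      (fun l => hM (some ⟨_, l⟩)) (s k).head?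
    obtain ⟨v2, h2⟩ := ihl M emb exit hM v1
    refine ⟨v2, ?_⟩
    rw [stepN, Nat.add_comm, Function.iterate_add_apply, Nat.add_comm 1 t,
      Function.iterate_succ_apply]
    refine Eq.trans (congrArg _ (Eq.trans (congrArg _ ?_) h1)) h2
    simp only [Prog.code] at h0
    rw [← Stacks.update_extend]
    refine (congrArg (fun q => some (TM2.stepAux q v s.extend)) h0).trans ?_
    simp only [TM2.stepAux]
    have : quit (s.extend (some k)).head? = false := hs
    rw [this]
    rfl

/-- The machine that runs the program `p` with its input on stack `0`, expects a single token
there at the end, and answers whether this token is `some true`. -/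
noncomputable def Prog.machine (p : Prog) : FinTM2 where
  K := Option (Fin 4)
  k₀ := some 0
  k₁ := none
  Γ := StackAlphabet
  Λ := Option p.Label
  main := some p.start
  ΛFin := by
    have := p.finite_label
    exact Fintype.ofFinite _
  σ := Option Tok
  initialState := none
  Γk₀Fin := inferInstanceAs (Fintype Tok)
  m := fun
    | some l => p.code some none l
    | none => .pop (some 0) (fun _ o => o)
        (.push none (fun o => decide (o = some (some true))) (.load (fun _ => none) .halt))

open Classical in
/-- A language is in P if a program decides it in polynomial time. -/
theorem inP_of_run (L : Language (Option Bool)) (p : Prog) (q : Polynomial ℕ)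
    (h : ∀ w : List Tok, ∃ t ≤ q.eval w.length,
      Run p (fun k => if k = 0 then w else [])
        (fun k => if k = 0 then [some (decide (w ∈ L))] else []) t) : InP L := by
  refine ⟨⟨⟨p.machine, Equiv.refl _, Equiv.refl _⟩, q + 1, fun w => ?_⟩⟩
  have h' := h w
  let t := h'.choose
  have ht : t ≤ q.eval w.length := h'.choose_spec.1
  have hr := h'.choose_spec.2
  refine ⟨⟨t + 1, ?_⟩, by simpa using ht⟩
  -- after the code of `p` at the labels `some l`, the label `none` writes the answer
  obtain ⟨v, hv⟩ := hr.simulate p.machine.m some none (fun _ => rfl) none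
  rw [Nat.add_comm, Function.iterate_add_apply]
  have hi : initList p.machine w =
      ⟨some (some p.start), none, Stacks.extend (fun k => if k = 0 then w else [])⟩ := by
    unfold initList
    congr 1
    funext k
    cases k with
    | none => rfl
    | some k =>
      by_cases hk : k = 0
      · subst hk
        rfl
      · have : (some k : Option (Fin 4)) ≠ some 0 := fun h => hk (Option.some.inj h)
        simp only [Stacks.extend, hk, if_false]
        exact dif_neg this
  refine Eq.trans (congrArg _ ?_) (b := (flip bind p.machine.step)^[1]
    (some ⟨some none, v, Stacks.extend
      (fun k => if k = 0 then [some (decide (w ∈ L))] else [])⟩)) ?_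
  · refine Eq.trans ?_ hv
    refine (congrArg (fun c => (flip bind p.machine.step)^[t] (some c)) ?_ :)
    refine Eq.trans ?_ hi
    exact congrArg (initList p.machine) (List.map_id w)
  · have : ∀ b : Bool, (flip bind p.machine.step)^[1]
        (some ⟨some none, v, Stacks.extend (fun k => if k = 0 then [some b] else [])⟩) =
        some (haltList p.machine [b]) := by
      intro b
      change some (TM2.stepAux _ _ _) = some _
      congr 1
      simp only [TM2.stepAux, Prog.machine, haltList]
      congr 1
      funext k
      cases k with
      | none => cases b <;> rfl
      | some k =>
        have hk : k = 0 ∨ k = 1 ∨ k = 2 ∨ k = 3 := by fin_cases k <;> simp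
        rcases hk with rfl | rfl | rfl | rfl <;> rfl
    exact this _

/-! ### Binary trees on stacks -/

/-- Binary trees with unlabelled leaves, the data type of all computations below. -/
inductive Data : Type
  | nil : Data
  | cons (x y : Data) : Data

/-- The preorder serialization of a tree. It is a prefix code, so that trees can be stacked on top
of each other without separators. -/
def Data.ser : Data → List Tok
  | .nil => [some false]
  | .cons x y => some true :: (x.ser ++ y.ser)

/-- The size of a tree, which is the number of its nodes. -/
def Data.size : Data → ℕ
  | .nil => 1
  | .cons x y => x.size + y.size + 1

@[simp] theorem Data.length_ser (x : Data) : x.ser.length = x.size := by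
  induction x with
  | nil => rfl
  | cons x y hx hy => simp [Data.ser, Data.size, hx, hy]

theorem Data.size_pos (x : Data) : 0 < x.size := by
  cases x <;> simp [Data.size]

theorem Data.none_notMem_ser (x : Data) : none ∉ x.ser := by
  induction x with
  | nil => simp [Data.ser]
  | cons x y hx hy => simp [Data.ser, hx, hy]

/-- The four stacks with given contents. Stack `0` holds the arguments, stacks `1` and `2` store
trees temporarily, and stack `3` is a counter. -/
def St (m a b c : List Tok) : Stacks
  | 0 => m
  | 1 => a
  | 2 => b
  | 3 => c

section
variable (m a b c l : List Tok)
@[simp] theorem St_zero : St m a b c 0 = m := rfl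
@[simp] theorem St_one : St m a b c 1 = a := rfl
@[simp] theorem St_two : St m a b c 2 = b := rfl
@[simp] theorem St_three : St m a b c 3 = c := rfl
@[simp] theorem St_update_zero : Function.update (St m a b c) 0 l = St l a b c := by
  funext k; fin_cases k <;> rfl
@[simp] theorem St_update_one : Function.update (St m a b c) 1 l = St m l b c := by
  funext k; fin_cases k <;> rfl
@[simp] theorem St_update_two : Function.update (St m a b c) 2 l = St m a l c := by
  funext k; fin_cases k <;> rfl
@[simp] theorem St_update_three : Function.update (St m a b c) 3 l = St m a b l := by
  funext k; fin_cases k <;> rfl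
end

/-- The program `p` leads from `s` to `s'` in at most `T` steps. -/
def Within (p : Prog) (s s' : Stacks) (T : ℕ) : Prop :=
  ∃ t ≤ T, Run p s s' t

theorem Within.mono {p : Prog} {s s' : Stacks} {T T' : ℕ} (h : Within p s s' T) (hT : T ≤ T') :
    Within p s s' T' :=
  let ⟨t, ht, hr⟩ := h
  ⟨t, ht.trans hT, hr⟩

theorem Within.skip (s : Stacks) : Within .skip s s 1 := ⟨1, le_rfl, .skip s⟩

theorem Within.push {k : Fin 4} {x : Tok} {s s' : Stacks}
    (h : Function.update s k (x :: s k) = s') : Within (.push k x) s s' 1 :=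
  h ▸ ⟨1, le_rfl, .push k x s⟩

theorem Within.seq {p q : Prog} {s s' s'' : Stacks} {T T' : ℕ} (h : Within p s s' T)
    (h' : Within q s' s'' T') : Within (.seq p q) s s'' (T + T') :=
  let ⟨t, ht, hr⟩ := h
  let ⟨t', ht', hr'⟩ := h'
  ⟨t + t', by omega, .seq hr hr'⟩

theorem Within.case {k : Fin 4} {f : Option Tok → Prog} {s s' : Stacks} {T : ℕ}
    {o : Option Tok} (ho : (s k).head? = o)
    (h : Within (f o) (Function.update s k (s k).tail) s' T) :
    Within (.case k f) s s' (1 + T) := by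
  subst ho
  obtain ⟨t, ht, hr⟩ := h
  exact ⟨1 + t, by omega, .case hr⟩

theorem Within.loop_exit {k : Fin 4} {quit : Option Tok → Bool} {body : Option Tok → Prog}
    {s s' : Stacks} (h : quit (s k).head? = true) (hs : Function.update s k (s k).tail = s') :
    Within (.loop k quit body) s s' 1 :=
  hs ▸ ⟨1, le_rfl, .loop_exit h⟩

theorem Within.loop_step {k : Fin 4} {quit : Option Tok → Bool} {body : Option Tok → Prog}
    {s s' s'' : Stacks} {T T' : ℕ} {o : Option Tok} (ho : (s k).head? = o) (h : quit o = false)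
    (hb : Within (body o) (Function.update s k (s k).tail) s' T)
    (hl : Within (.loop k quit body) s' s'' T') :
    Within (.loop k quit body) s s'' (1 + T + T') := by
  subst ho
  obtain ⟨t, ht, hr⟩ := hb
  obtain ⟨t', ht', hr'⟩ := hl
  exact ⟨1 + t + t', by omega, .loop_step h hr hr'⟩

/-- The body of the loop that moves one tree: move one token to stack `k`, and update the number
of subtrees that are still to be moved, which is kept in unary on the counter. -/
def moveStep (k : Fin 4) : Prog :=
  .case 0 fun o => match o with
    | some x => .seq (.push k x)
        (match x with
          | some true => .seq (.push 3 none) (.push 3 none)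
          | _ => .skip)
    | none => .skip

/-- Move the tree on top of stack `0` to stack `k`, above a mark; its tokens get reversed. -/
def store (k : Fin 4) : Prog :=
  .seq (.push k none) (.seq (.push 3 none) (.loop 3 Option.isNone fun _ => moveStep k))

/-- Run `p` of each token above the topmost mark of stack `k`, and delete these tokens and the
mark. -/
def drain (k : Fin 4) (p : Tok → Prog) : Prog :=
  .loop k (fun o => o = none ∨ o = some none) fun o => match o with
    | some x => p x
    | none => .skip

/-- Move a stored tree back from stack `k` to stack `0`. -/
def restore (k : Fin 4) : Prog := drain k (.push 0)

/-- Delete the tree on top of stack `0`. -/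
def dropTree : Prog := .seq (store 1) (drain 1 fun _ => .skip)

/-- Exchange the two trees on top of stack `0`. -/
def swapTrees : Prog :=
  .seq (store 1) (.seq (store 2) (.seq (restore 1) (restore 2)))

/-- From the top of stack `0`, turn the trees `x, y, z` into `x, z, y`. -/
def rotTrees : Prog :=
  .seq (store 1) (.seq (store 2) (.seq (store 1) (.seq (restore 2) (.seq (restore 1) (restore 1)))))

/-- Duplicate the tree on top of stack `0`. -/
def dupTree : Prog :=
  .seq (store 1) (.seq (.push 2 none)
    (.seq (drain 1 fun x => .seq (.push 0 x) (.push 2 x))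
      (.seq (.push 1 none) (.seq (drain 2 (.push 1)) (restore 1)))))

/-- The loop that moves trees terminates exactly after as many trees as the counter says, because
a pair replaces one pending tree by two. -/
theorem moveLoop_one (ts : List Data) (m a b : List Tok) :
    Within (.loop 3 Option.isNone fun _ => moveStep 1)
      (St ((ts.map Data.ser).flatten ++ m) a b (List.replicate ts.length none))
      (St m ((ts.map Data.ser).flatten.reverse ++ a) b [])
      (6 * (ts.map Data.size).sum + 1) := by
  induction h : (ts.map Data.size).sum using Nat.strong_induction_on generalizing ts a with
  | _ n ih =>
  subst h
  match ts with
  | [] => exact Within.mono (Within.loop_exit rfl (by simp)) (by simp)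
  | .nil :: ts =>
    have := ih _ (by simp [Data.size]) ts (some false :: a) rfl
    refine Within.mono (Within.loop_step (o := some none) (T := 3) rfl rfl
      (s' := St ((ts.map Data.ser).flatten ++ m) (some false :: a) b
        (List.replicate ts.length none)) ?_ (T' := 6 * (ts.map Data.size).sum + 1) ?_) ?_
    · refine Within.mono (Within.case (o := some (some false)) (by simp [Data.ser]) ((Within.push
        (s' := St ((ts.map Data.ser).flatten ++ m) (some false :: a) b
          (List.replicate ts.length none)) ?_).seq (Within.skip _))) (by omega)
      simp [Data.ser, List.replicate_succ]
    · simpa [Data.ser] using this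
    · simp [Data.size]; omega
  | .cons x y :: ts =>
    have := ih _ (by simp [Data.size]; omega) (x :: y :: ts) (some true :: a) rfl
    refine Within.mono (Within.loop_step (o := some none) (T := 4) rfl rfl
      (s' := St (((x :: y :: ts).map Data.ser).flatten ++ m) (some true :: a) b
        (List.replicate (x :: y :: ts).length none)) ?_
        (T' := 6 * ((x :: y :: ts).map Data.size).sum + 1) ?_) ?_
    · refine Within.mono (Within.case (o := some (some true)) (by simp [Data.ser]) ((Within.push
        (s' := St (((x :: y :: ts).map Data.ser).flatten ++ m) (some true :: a) b
          (List.replicate ts.length none)) ?_).seq ((Within.push rfl).seq (Within.push ?_))))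
          (by omega)
      · simp [Data.ser, List.replicate_succ]
      · simp [List.replicate_succ]
    · simpa [Data.ser] using this
    · simp [Data.size]; omega

theorem moveLoop_two (ts : List Data) (m a b : List Tok) :
    Within (.loop 3 Option.isNone fun _ => moveStep 2)
      (St ((ts.map Data.ser).flatten ++ m) a b (List.replicate ts.length none))
      (St m a ((ts.map Data.ser).flatten.reverse ++ b) [])
      (6 * (ts.map Data.size).sum + 1) := by
  induction h : (ts.map Data.size).sum using Nat.strong_induction_on generalizing ts b with
  | _ n ih =>
  subst h
  match ts with
  | [] => exact Within.mono (Within.loop_exit rfl (by simp)) (by simp)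
  | .nil :: ts =>
    have := ih _ (by simp [Data.size]) ts (some false :: b) rfl
    refine Within.mono (Within.loop_step (o := some none) (T := 3) rfl rfl
      (s' := St ((ts.map Data.ser).flatten ++ m) a (some false :: b)
        (List.replicate ts.length none)) ?_ (T' := 6 * (ts.map Data.size).sum + 1) ?_) ?_
    · refine Within.mono (Within.case (o := some (some false)) (by simp [Data.ser]) ((Within.push
        (s' := St ((ts.map Data.ser).flatten ++ m) a (some false :: b)
          (List.replicate ts.length none)) ?_).seq (Within.skip _))) (by omega)
      simp [Data.ser, List.replicate_succ]
    · simpa [Data.ser] using this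
    · simp [Data.size]; omega
  | .cons x y :: ts =>
    have := ih _ (by simp [Data.size]; omega) (x :: y :: ts) (some true :: b) rfl
    refine Within.mono (Within.loop_step (o := some none) (T := 4) rfl rfl
      (s' := St (((x :: y :: ts).map Data.ser).flatten ++ m) a (some true :: b)
        (List.replicate (x :: y :: ts).length none)) ?_
        (T' := 6 * ((x :: y :: ts).map Data.size).sum + 1) ?_) ?_
    · refine Within.mono (Within.case (o := some (some true)) (by simp [Data.ser]) ((Within.push
        (s' := St (((x :: y :: ts).map Data.ser).flatten ++ m) a (some true :: b)
          (List.replicate ts.length none)) ?_).seq ((Within.push rfl).seq (Within.push ?_))))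
          (by omega)
      · simp [Data.ser, List.replicate_succ]
      · simp [List.replicate_succ]
    · simpa [Data.ser] using this
    · simp [Data.size]; omega

/-- A tree as it is stored on stack `1` or `2`. -/
def Data.stored (x : Data) (l : List Tok) : List Tok := x.ser.reverse ++ none :: l

theorem store_one (x : Data) (m a b : List Tok) :
    Within (store 1) (St (x.ser ++ m) a b []) (St m (x.stored a) b []) (6 * x.size + 3) := by
  refine Within.mono ((Within.push rfl).seq ((Within.push rfl).seq
    (T' := 6 * x.size + 1) ?_)) (by omega)
  simpa [Data.stored] using moveLoop_one [x] m (none :: a) b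

theorem store_two (x : Data) (m a b : List Tok) :
    Within (store 2) (St (x.ser ++ m) a b []) (St m a (x.stored b) []) (6 * x.size + 3) := by
  refine Within.mono ((Within.push rfl).seq ((Within.push rfl).seq
    (T' := 6 * x.size + 1) ?_)) (by omega)
  simpa [Data.stored] using moveLoop_two [x] m a (none :: b)

/-- Draining a stack: `F l` are the stacks after the tokens `l` have been treated. -/
theorem drain_run {k : Fin 4} {p : Tok → Prog} {l rest : List Tok} {F : List Tok → Stacks}
    {n : ℕ} (hl : none ∉ l) (hF : ∀ l' l'', l = l' ++ l'' → (F l') k = l'' ++ none :: rest)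
    (hp : ∀ l' x l'', l = l' ++ x :: l'' →
      Within (p x) (Function.update (F l') k (l'' ++ none :: rest)) (F (l' ++ [x])) n) :
    Within (drain k p) (F []) (Function.update (F l) k rest) (l.length * (n + 1) + 1) := by
  suffices ∀ l' l'', l = l' ++ l'' → Within (drain k p) (F l')
      (Function.update (F l) k rest) (l''.length * (n + 1) + 1) from this [] l rfl
  intro l' l''
  induction l'' generalizing l' with
  | nil =>
    intro h
    have hk := hF l' [] h
    simp only [List.append_nil] at h
    subst h
    exact Within.mono (Within.loop_exit (by simp [hk]) (by simp [hk])) (by simp)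
  | cons x l'' ih =>
    intro h
    have hx : x ≠ none := by
      rintro rfl
      exact hl (by simp [h])
    have hk := hF l' _ h
    refine Within.mono (Within.loop_step (o := some x) (T := n) (by simp [hk]) (by simp [hx])
      ?_ (ih (l' ++ [x]) (by simp [h]))) (by simp [add_mul]; omega)
    have := hp l' x l'' h
    rw [hk]
    exact this

theorem Data.none_notMem_reverse_ser (x : Data) : none ∉ x.ser.reverse := by
  simpa using x.none_notMem_ser

theorem restore_one (x : Data) (m a b c : List Tok) :
    Within (restore 1) (St m (x.stored a) b c) (St (x.ser ++ m) a b c) (2 * x.size + 1) := by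
  have := drain_run (k := 1) (p := .push 0) (l := x.ser.reverse) (rest := a) (n := 1)
    (F := fun l => St (l.reverse ++ m) (x.ser.reverse.drop l.length ++ none :: a) b c)
    x.none_notMem_reverse_ser (fun l' l'' h => by simp [h])
    (fun l' y l'' h => Within.push (by simp [h]))
  simpa [Data.stored, mul_comm, restore] using this

theorem restore_two (x : Data) (m a b c : List Tok) :
    Within (restore 2) (St m a (x.stored b) c) (St (x.ser ++ m) a b c) (2 * x.size + 1) := by
  have := drain_run (k := 2) (p := .push 0) (l := x.ser.reverse) (rest := b) (n := 1)
    (F := fun l => St (l.reverse ++ m) a (x.ser.reverse.drop l.length ++ none :: b) c)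
    x.none_notMem_reverse_ser (fun l' l'' h => by simp [h])
    (fun l' y l'' h => Within.push (by simp [h]))
  simpa [Data.stored, mul_comm, restore] using this

theorem dropTree_run (x : Data) (m a b : List Tok) :
    Within dropTree (St (x.ser ++ m) a b []) (St m a b []) (8 * x.size + 4) := by
  have := drain_run (k := 1) (p := fun _ => .skip) (l := x.ser.reverse) (rest := a) (n := 1)
    (F := fun l => St m (x.ser.reverse.drop l.length ++ none :: a) b [])
    x.none_notMem_reverse_ser (fun l' l'' h => by simp [h])
    (fun l' y l'' h => by simpa [h] using Within.skip (St m (l'' ++ none :: a) b []))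
  refine Within.mono ((store_one x m a b).seq (T' := 2 * x.size + 1) ?_) (by omega)
  simpa [Data.stored, mul_comm, restore] using this

theorem swapTrees_run (x y : Data) (m a b : List Tok) :
    Within swapTrees (St (x.ser ++ (y.ser ++ m)) a b []) (St (y.ser ++ (x.ser ++ m)) a b [])
      (8 * x.size + 8 * y.size + 8) :=
  Within.mono ((store_one _ _ _ _).seq ((store_two _ _ _ _).seq
    ((restore_one _ _ _ _ _).seq (restore_two _ _ _ _ _)))) (by omega)

theorem rotTrees_run (x y z : Data) (m a b : List Tok) :
    Within rotTrees (St (x.ser ++ (y.ser ++ (z.ser ++ m))) a b [])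
      (St (x.ser ++ (z.ser ++ (y.ser ++ m))) a b [])
      (8 * x.size + 8 * y.size + 8 * z.size + 12) :=
  Within.mono ((store_one _ _ _ _).seq ((store_two _ _ _ _).seq ((store_one _ _ _ _).seq
    ((restore_two _ _ _ _ _).seq ((restore_one _ _ _ _ _).seq (restore_one _ _ _ _ _))))))
    (by omega)

theorem dupTree_run (x : Data) (m a b : List Tok) :
    Within dupTree (St (x.ser ++ m) a b []) (St (x.ser ++ (x.ser ++ m)) a b [])
      (13 * x.size + 8) := by
  have h1 := drain_run (k := 1) (p := fun x => .seq (.push 0 x) (.push 2 x)) (l := x.ser.reverse)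
    (rest := a) (n := 2)
    (F := fun l => St (l.reverse ++ m) (x.ser.reverse.drop l.length ++ none :: a)
      (l.reverse ++ none :: b) [])
    x.none_notMem_reverse_ser (fun l' l'' h => by simp [h])
    (fun l' y l'' h => (Within.push rfl).seq (Within.push (by simp [h])))
  have h2 := drain_run (k := 2) (p := .push 1) (l := x.ser)
    (rest := b) (n := 1)
    (F := fun l => St (x.ser ++ m) (l.reverse ++ none :: a) (x.ser.drop l.length ++ none :: b) [])
    x.none_notMem_ser (fun l' l'' h => by simp [h])
    (fun l' y l'' h => Within.push (by simp [h]))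
  refine Within.mono ((store_one x m a b).seq ((Within.push rfl).seq (Within.seq (T := 3 * x.size + 1)
    (s' := St (x.ser ++ m) a (x.ser ++ none :: b) []) ?_ ((Within.push rfl).seq (Within.seq
    (T := 2 * x.size + 1) (s' := St (x.ser ++ m) (x.stored a) b []) ?_ (restore_one x _ a b []))))))
    (by omega)
  · simpa [Data.stored, mul_comm] using h1
  · simpa [Data.stored, mul_comm] using h2

/-! ### Polynomial-time functions between encoded types -/

/-- Types whose elements are encoded as trees. -/
class Enc (α : Type) where
  /-- The tree that encodes an element. -/
  enc : α → Data

open Enc (enc)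

/-- The size of the code of an element. -/
def size {α : Type} [Enc α] (a : α) : ℕ := (enc a).size

/-- The two truth values have codes of the same size, so that the size of the code of a number
depends on its number of bits only. -/
instance : Enc Bool where
  enc
    | true => .cons (.cons .nil .nil) .nil
    | false => .cons .nil (.cons .nil .nil)

instance {α β : Type} [Enc α] [Enc β] : Enc (α × β) where
  enc x := .cons (enc x.1) (enc x.2)

/-- The tree that encodes a list. -/
def encList {α : Type} [Enc α] : List α → Data
  | [] => .nil
  | a :: l => .cons (enc a) (encList l)

instance {α : Type} [Enc α] : Enc (List α) where
  enc := encList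

instance {α : Type} [Enc α] : Enc (Option α) where
  enc o := enc o.toList

/-- Natural numbers are encoded in binary. -/
instance : Enc ℕ where
  enc n := enc n.bits

/-- `Computes p x y T`: the program `p` replaces the tree `x` on top of stack `0` by the tree `y`
in at most `T` steps. -/
def Computes (p : Prog) (x y : Data) (T : ℕ) : Prop :=
  ∀ m a b, Within p (St (x.ser ++ m) a b []) (St (y.ser ++ m) a b []) T

section
variable {α β γ δ : Type} [Enc α] [Enc β] [Enc γ] [Enc δ]

/-- `g` is bounded by a polynomial in the size of the code of its argument. -/
def PolyBd (g : α → ℕ) : Prop := ∃ q : Polynomial ℕ, ∀ a, g a ≤ q.eval (size a)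

/-- `f` is computed in polynomial time by a program on trees. -/
@[fun_prop]
def PolyTime (f : α → β) : Prop :=
  ∃ (p : Prog) (T : α → ℕ), PolyBd T ∧ ∀ a, Computes p (enc a) (enc (f a)) (T a)

theorem polynomial_eval_mono (q : Polynomial ℕ) {m n : ℕ} (h : m ≤ n) : q.eval m ≤ q.eval n := by
  rw [Polynomial.eval_eq_sum_range, Polynomial.eval_eq_sum_range]
  gcongr

theorem PolyBd.mono {g g' : α → ℕ} (h : PolyBd g) (hg : ∀ a, g' a ≤ g a) : PolyBd g' :=
  let ⟨q, hq⟩ := h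
  ⟨q, fun a => (hg a).trans (hq a)⟩

theorem PolyBd.const (n : ℕ) : PolyBd fun _ : α => n := ⟨.C n, fun a => by simp⟩

theorem PolyBd.size : PolyBd fun a : α => size a := ⟨.X, fun a => by simp⟩

theorem PolyBd.add {g g' : α → ℕ} (h : PolyBd g) (h' : PolyBd g') :
    PolyBd fun a => g a + g' a :=
  let ⟨q, hq⟩ := h
  let ⟨q', hq'⟩ := h'
  ⟨q + q', fun a => by simpa using add_le_add (hq a) (hq' a)⟩

theorem PolyBd.mul {g g' : α → ℕ} (h : PolyBd g) (h' : PolyBd g') :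
    PolyBd fun a => g a * g' a :=
  let ⟨q, hq⟩ := h
  let ⟨q', hq'⟩ := h'
  ⟨q * q', fun a => by simpa using Nat.mul_le_mul (hq a) (hq' a)⟩

theorem PolyBd.comp {g : β → ℕ} {f : α → β} (h : PolyBd g)
    (hf : PolyBd fun a => SavRobustness.size (f a)) : PolyBd fun a => g (f a) :=
  let ⟨q, hq⟩ := h
  let ⟨q', hq'⟩ := hf
  ⟨q.comp q', fun a => by
    simpa using (hq (f a)).trans (polynomial_eval_mono q (hq' a))⟩

theorem PolyBd.eval (q : Polynomial ℕ) {g : α → ℕ} (h : PolyBd g) :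
    PolyBd fun a => q.eval (g a) :=
  let ⟨q', hq'⟩ := h
  ⟨q.comp q', fun a => by simpa using polynomial_eval_mono q (hq' a)⟩

/-- Every step adds at most one token, so that a program that runs for a short time only writes
short output. -/
theorem Run.sum_length_le {p : Prog} {s s' : Stacks} {t : ℕ} (h : Run p s s' t) :
    ∑ k, (s' k).length ≤ ∑ k, (s k).length + t := by
  have upd : ∀ (s : Stacks) (k : Fin 4) (l : List Tok) (n : ℕ), l.length ≤ (s k).length + n →
      ∑ j, (Function.update s k l j).length ≤ ∑ j, (s j).length + n := by
    intro s k l n hl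
    rw [← Finset.add_sum_erase _ _ (Finset.mem_univ k),
      ← Finset.add_sum_erase _ (fun j => (s j).length) (Finset.mem_univ k)]
    have : ∑ j ∈ Finset.univ.erase k, (Function.update s k l j).length =
        ∑ j ∈ Finset.univ.erase k, (s j).length :=
      Finset.sum_congr rfl fun j hj => by
        rw [Function.update_of_ne (Finset.ne_of_mem_erase hj)]
    rw [this, Function.update_self]
    omega
  have upd' := fun (s : Stacks) (k : Fin 4) => upd s k (s k).tail 0 (by simp)
  induction h with
  | skip => omega
  | push k x s => exact upd s k _ 1 (by simp)
  | seq _ _ h h' => omega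
  | @case k f s s' t _ h =>
    have := upd' s k
    omega
  | @loop_exit k _ _ s _ =>
    have := upd' s k
    omega
  | @loop_step k _ _ s _ _ _ _ _ _ _ h h' =>
    have := upd' s k
    omega

theorem Computes.size_le {p : Prog} {x y : Data} {T : ℕ} (h : Computes p x y T) :
    y.size ≤ x.size + T := by
  obtain ⟨t, ht, hr⟩ := h [] [] []
  have := hr.sum_length_le
  simp [Fin.sum_univ_four] at this
  omega

theorem Computes.mono {p : Prog} {x y : Data} {T T' : ℕ} (h : Computes p x y T) (hT : T ≤ T') :
    Computes p x y T' := fun m a b => (h m a b).mono hT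

theorem PolyTime.size_bd {f : α → β} (h : PolyTime f) : PolyBd fun a => size (f a) :=
  let ⟨_, _, hT, hp⟩ := h
  (PolyBd.size.add hT).mono fun a => (hp a).size_le

theorem PolyTime.of_enc {f : α → β} {g : γ → δ} {h : α → γ} (hg : PolyTime g)
    (hi : ∀ a, enc (h a) = enc a) (ho : ∀ a, enc (g (h a)) = enc (f a)) : PolyTime f := by
  obtain ⟨p, T, ⟨q, hT⟩, hp⟩ := hg
  refine ⟨p, fun a => T (h a), ⟨q, fun a => ?_⟩, fun a => ?_⟩
  · have := hT (h a)
    rwa [SavRobustness.size, hi] at this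
  · have := hp (h a)
    rwa [hi, ho] at this

/-- Functions whose values have the same codes are computed by the same program. -/
theorem PolyTime.of_enc_eq {f : α → β} {g : α → γ} (hg : PolyTime g)
    (h : ∀ a, enc (g a) = enc (f a)) : PolyTime f :=
  hg.of_enc (h := _root_.id) (fun _ => rfl) h

@[fun_prop]
theorem PolyTime.id : PolyTime fun a : α => a :=
  ⟨.skip, fun _ => 1, .const 1, fun _ _ _ _ => Within.skip _⟩

@[fun_prop]
theorem PolyTime.comp {g : β → γ} {f : α → β} (hg : PolyTime g) (hf : PolyTime f) :
    PolyTime fun a => g (f a) :=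
  let ⟨p, _, hT, hp⟩ := hg
  let ⟨p', _, hT', hp'⟩ := hf
  ⟨.seq p' p, _, hT'.add (hT.comp hf.size_bd), fun a m u v =>
    (hp' a m u v).seq (hp (f a) m u v)⟩

/-- Put a tree on stack `0`. -/
def pushData : Data → Prog
  | .nil => .push 0 (some false)
  | .cons x y => .seq (pushData y) (.seq (pushData x) (.push 0 (some true)))

theorem pushData_run (x : Data) (m a b c : List Tok) :
    Within (pushData x) (St m a b c) (St (x.ser ++ m) a b c) x.size := by
  induction x generalizing m with
  | nil => exact Within.push (by simp [Data.ser])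
  | cons x y hx hy =>
    refine Within.mono ((hy m).seq ((hx _).seq (Within.push ?_))) (by simp [Data.size]; omega)
    simp [Data.ser]

@[fun_prop]
theorem PolyTime.const (b : β) : PolyTime fun _ : α => b :=
  ⟨.seq dropTree (pushData (enc b)), _, ((((PolyBd.const 8).mul .size).add (.const 4)).add
    (.const (enc b).size)), fun a m u v =>
    (dropTree_run (enc a) m u v).seq (pushData_run (enc b) m u v _)⟩

@[fun_prop]
theorem PolyTime.pair {f : α → β} {g : α → γ} (hf : PolyTime f) (hg : PolyTime g) :
    PolyTime fun a => (f a, g a) := by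
  obtain ⟨p, T, hT, hp⟩ := hf
  obtain ⟨p', T', hT', hp'⟩ := _root_.id hg
  refine ⟨.seq dupTree (.seq p' (.seq swapTrees (.seq p (.push 0 (some true))))), _,
    ((((PolyBd.const 13).mul .size).add (.const 8)).add (hT'.add
    (((((PolyBd.const 8).mul hg.size_bd).add ((PolyBd.const 8).mul .size)).add (.const 8)).add
    (hT.add (.const 1))))), fun a m u v => ?_⟩
  refine (dupTree_run _ _ _ _).seq ((hp' a _ u v).seq ((swapTrees_run _ _ _ _ _).seq
    ((hp a _ u v).seq (Within.push ?_))))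
  simp [enc, Data.ser]

@[fun_prop]
theorem PolyTime.fst {f : α → β × γ} (hf : PolyTime f) : PolyTime fun a => (f a).1 := by
  suffices PolyTime (Prod.fst : β × γ → β) from this.comp hf
  refine ⟨.case 0 fun _ => .seq swapTrees dropTree, _, (((PolyBd.const 16).mul .size).add
    (.const 13)), fun x m u v => ?_⟩
  refine Within.mono (Within.case rfl (Within.seq (T := 8 * (enc x.1).size + 8 * (enc x.2).size + 8)
    (s' := St ((enc x.2).ser ++ ((enc x.1).ser ++ m)) u v []) ?_ (dropTree_run _ _ _ _)))
    (by simp [SavRobustness.size, enc, Data.size]; omega)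
  simpa [enc, Data.ser] using swapTrees_run (enc x.1) (enc x.2) m u v

@[fun_prop]
theorem PolyTime.snd {f : α → β × γ} (hf : PolyTime f) : PolyTime fun a => (f a).2 := by
  suffices PolyTime (Prod.snd : β × γ → γ) from this.comp hf
  refine ⟨.case 0 fun _ => dropTree, _, (((PolyBd.const 8).mul .size).add
    (.const 5)), fun x m u v => ?_⟩
  refine Within.mono (Within.case rfl (T := 8 * (enc x.1).size + 4) ?_)
    (by simp [SavRobustness.size, enc, Data.size]; omega)
  simpa [enc, Data.ser] using dropTree_run (enc x.1) ((enc x.2).ser ++ m) u v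

theorem Within.case_zero {f : Option Tok → Prog} {x : Tok} {m a b c : List Tok} {s : Stacks}
    {T : ℕ} (h : Within (f (some x)) (St m a b c) s T) :
    Within (.case 0 f) (St (x :: m) a b c) s (1 + T) :=
  Within.case rfl (by simpa using h)

/-- Pop a token from stack `0` and go on with `p`. -/
def popThen (p : Prog) : Prog := .case 0 fun _ => p

theorem popThen_run {p : Prog} {x : Tok} {m a b c : List Tok} {s : Stacks} {T : ℕ}
    (h : Within p (St m a b c) s T) : Within (popThen p) (St (x :: m) a b c) s (1 + T) :=
  Within.case rfl (by simpa using h)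

@[fun_prop]
theorem PolyTime.ite {c : α → Bool} {f g : α → β} (hc : PolyTime c) (hf : PolyTime f)
    (hg : PolyTime g) : PolyTime fun a => if c a then f a else g a := by
  suffices PolyTime fun x : Bool × α => if x.1 then f x.2 else g x.2 from
    this.comp (hc.pair .id)
  obtain ⟨p, T, hT, hp⟩ := hf
  obtain ⟨p', T', hT', hp'⟩ := hg
  have hs : PolyBd fun x : Bool × α => size x.2 := (PolyTime.snd .id).size_bd
  refine ⟨popThen (popThen (.case 0 fun o => match o with
    | some (some true) => popThen (popThen (popThen p))
    | _ => popThen (popThen (popThen p')))), _, (PolyBd.const 6).add ((hT.comp hs).add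
    (hT'.comp hs)), ?_⟩
  rintro ⟨c, x⟩ m u v
  cases c
  · refine Within.mono (popThen_run (popThen_run (Within.case_zero (x := some false)
      (popThen_run (popThen_run (popThen_run (hp' x m u v))))))) (by simp; omega)
  · refine Within.mono (popThen_run (popThen_run (Within.case_zero (x := some true)
      (popThen_run (popThen_run (popThen_run (hp x m u v))))))) (by simp; omega)

@[fun_prop]
theorem PolyTime.list_cons {f : α → β} {g : α → List β} (hf : PolyTime f) (hg : PolyTime g) :
    PolyTime fun a => f a :: g a :=
  (hf.pair hg).of_enc_eq fun _ => rfl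

/-- Case distinction on a list. -/
theorem PolyTime.list_casesOn {l : α → List β} {f : α → γ} {g : α → β → List β → γ}
    (hl : PolyTime l) (hf : PolyTime f)
    (hg : PolyTime fun x : α × β × List β => g x.1 x.2.1 x.2.2) :
    PolyTime fun a => (match l a with
      | [] => f a
      | x :: t => g a x t : γ) := by
  suffices PolyTime fun x : List β × α => (match x.1 with
      | [] => f x.2
      | y :: t => g x.2 y t : γ) from this.comp (hl.pair .id)
  obtain ⟨p, T, ⟨q, hT⟩, hp⟩ := hf
  obtain ⟨p', T', ⟨q', hT'⟩, hp'⟩ := hg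
  refine ⟨popThen (.case 0 fun o => match o with
    | some (some true) =>
      .seq (.push 0 (some true)) (.seq swapTrees (.seq (.push 0 (some true)) p'))
    | _ => p), _,
    (PolyBd.const 12).add (((PolyBd.const 8).mul .size).add ((PolyBd.eval q .size).add
      (PolyBd.eval q' .size))), ?_⟩
  rintro ⟨l, a⟩ m u v
  cases l with
  | nil =>
    refine Within.mono (popThen_run (Within.case_zero (x := some false) (hp a m u v))) ?_
    have := (hT a).trans (polynomial_eval_mono q (n := size (([] : List β), a))
      (by simp [SavRobustness.size, enc, Data.size]; omega))
    omega
  | cons y t =>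
    refine Within.mono (popThen_run (Within.case_zero (x := some true) (Within.seq (Within.push rfl)
      (Within.seq (s' := St ((enc a).ser ++ ((enc (y, t)).ser ++ m)) u v [])
        (T := 8 * (enc (y, t)).size + 8 * (enc a).size + 8) ?_
        (Within.seq (Within.push rfl) (T' := T' (a, y, t)) ?_))))) ?_
    · simpa [enc, encList, Data.ser] using swapTrees_run (enc (y, t)) (enc a) m u v
    · simpa [enc, Data.ser] using hp' (a, y, t) m u v
    · have := (hT' (a, y, t)).trans (polynomial_eval_mono q' (n := size (y :: t, a))
        (by simp [SavRobustness.size, enc, encList, Data.size]; omega))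
      simp [SavRobustness.size, enc, encList, Data.size] at *
      omega

/-- A loop over a list, whose body `p` turns pairs of an element and a state into a state. -/
def forLoop (p : Prog) : Prog :=
  .loop 0 (fun o => o ≠ some (some true)) fun _ =>
    .seq rotTrees (.seq (.push 0 (some true)) (.seq p swapTrees))

/-- The loop computes a left fold; `N` bounds the sizes of the intermediate states, and `T` the
running time of the body. -/
theorem forLoop_run {p : Prog} {step : β → α → β} {N T : ℕ} (l : List α) (s : β)
    (m a b : List Tok)
    (h : ∀ l' x l'', l = l' ++ x :: l'' →
      Computes p (enc (x, l'.foldl step s)) (enc ((l' ++ [x]).foldl step s)) T)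
    (hN : ∀ l' l'', l = l' ++ l'' → size (l'.foldl step s) ≤ N) :
    Within (forLoop p) (St ((enc l).ser ++ ((enc s).ser ++ m)) a b [])
      (St ((enc (l.foldl step s)).ser ++ m) a b [])
      (l.length * (16 * N + 16 * (enc l).size + T + 22) + 1) := by
  induction l generalizing s with
  | nil => exact Within.mono (Within.loop_exit rfl (by simp [enc, encList, Data.ser])) (by simp)
  | cons x l ih =>
    have h0 := hN [] (x :: l) rfl
    have h1 := hN [x] l rfl
    refine Within.mono (Within.loop_step (T := 16 * N + 16 * (enc (x :: l)).size + T + 21)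
      (s' := St ((enc l).ser ++ ((enc (step s x)).ser ++ m)) a b []) (o := some (some true)) rfl
      (by simp)
      ?_ (ih (step s x) (fun l' y l'' hl => ?_) fun l' l'' hl => ?_)) ?_
    · have hr := rotTrees_run (enc x) (enc l) (enc s) m a b
      have hp := h [] x l rfl ((enc l).ser ++ m) a b
      refine Within.mono (Within.seq (s' := St ((enc x).ser ++ ((enc s).ser ++ ((enc l).ser ++ m)))
        a b []) (T := 8 * (enc x).size + 8 * (enc l).size + 8 * (enc s).size + 12) ?_
        ((Within.push rfl).seq (Within.seq (T := T) (s' := St ((enc (step s x)).ser ++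
          ((enc l).ser ++ m)) a b []) ?_ (swapTrees_run _ _ _ _ _)))) ?_
      · simpa [enc, encList, Data.ser] using hr
      · simpa [enc, Data.ser] using hp
      · simp [enc, encList, Data.size, SavRobustness.size] at *
        omega
    · exact h (x :: l') y l'' (by simp [hl])
    · exact hN (x :: l') l'' (by simp [hl])
    · simp only [List.length_cons, add_mul, one_mul]
      have : l.length * (16 * N + 16 * (enc l).size + T + 22) ≤
          l.length * (16 * N + 16 * (enc (x :: l)).size + T + 22) := by
        apply Nat.mul_le_mul_left
        simp [enc, encList, Data.size]
        omega
      simp only [mul_add] at this ⊢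
      omega

theorem List.length_le_size (l : List α) : l.length ≤ size l := by
  induction l with
  | nil => simp
  | cons x l ih =>
    simp [SavRobustness.size, enc, encList, Data.size] at *
    omega

theorem size_mk (x : α) (y : β) : size (x, y) = size x + size y + 1 := rfl

theorem size_nil : size ([] : List α) = 1 := rfl

theorem size_cons (x : α) (l : List α) : size (x :: l) = size x + size l + 1 := rfl

theorem size_append (l l' : List α) : size (l ++ l') + 1 = size l + size l' := by
  induction l with
  | nil => simp [size_nil, add_comm]
  | cons x l ih => simp only [List.cons_append, size_cons]; omega

theorem size_pos (x : α) : 0 < size x := Data.size_pos _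

/-- Iteration over a list is possible in polynomial time if the intermediate results have
polynomially bounded size. -/
theorem PolyTime.foldl {init : α → γ} {l : α → List β} {step : α → γ → β → γ}
    (hinit : PolyTime init) (hl : PolyTime l)
    (hstep : PolyTime fun x : α × γ × β => step x.1 x.2.1 x.2.2)
    {B : α → ℕ} (hB : PolyBd B)
    (hb : ∀ a l' l'', l a = l' ++ l'' → size (l'.foldl (step a) (init a)) ≤ B a) :
    PolyTime fun a => (l a).foldl (step a) (init a) := by
  have h0 : PolyTime fun a => (l a, (a, init a)) := hl.pair (.pair .id hinit)
  obtain ⟨p, T, ⟨q, hT⟩, hp⟩ : PolyTime fun y : β × α × γ => (y.2.1, step y.2.1 y.2.2 y.1) :=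
    PolyTime.pair (.fst (.snd .id)) (hstep.comp
      (f := fun y : β × α × γ => (y.2.1, y.2.2, y.1))
      (.pair (.fst (.snd .id)) (.pair (.snd (.snd .id)) (.fst .id))))
  suffices PolyTime fun a => (a, (l a).foldl (step a) (init a)) from this.snd
  obtain ⟨p0, T0, hT0, hp0⟩ := _root_.id h0
  let N : α → ℕ := fun a => size a + B a + 1
  have hN : PolyBd N := (PolyBd.size.add hB).add (.const 1)
  refine ⟨.seq p0 (popThen (forLoop p)), _, hT0.add ((PolyBd.const 1).add ((hl.size_bd.mul
    (((((PolyBd.const 16).mul hN).add ((PolyBd.const 16).mul hl.size_bd)).add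
    (PolyBd.eval q ((hl.size_bd.add hN).add (.const 1)))).add (.const 22))).add (.const 1))),
    fun a m u v => ?_⟩
  refine (hp0 a m u v).seq ?_
  -- the parameter `a` is carried along as a part of the state
  have key : ∀ l' : List β, l'.foldl (fun s x => (s.1, step s.1 s.2 x)) (a, init a) =
      (a, l'.foldl (step a) (init a)) := by
    intro l'
    induction l' using List.reverseRecOn with
    | nil => rfl
    | append_singleton l' x ih => simp [List.foldl_append, ih]
  have hloop := forLoop_run (p := p) (step := fun (s : α × γ) x => (s.1, step s.1 s.2 x))
    (N := N a) (T := q.eval (size (l a) + N a + 1)) (l a) (a, init a) m u v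
    (fun l' x l'' h => ?_) (fun l' l'' h => ?_)
  · rw [key] at hloop
    refine Within.mono (popThen_run (T := (l a).length * (16 * N a + 16 * (enc (l a)).size +
      q.eval (size (l a) + N a + 1) + 22) + 1) (by simpa using hloop)) ?_
    have := List.length_le_size (l a)
    gcongr
    rfl
  · rw [List.foldl_append, key]
    refine (hp (x, a, l'.foldl (step a) (init a))).mono ((hT _).trans (polynomial_eval_mono q ?_))
    have h1 := hb a l' _ h
    have h2 := size_append l' (x :: l'')
    have h3 := size_pos l'
    rw [← h, size_cons] at h2
    simp only [size_mk, N]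
    omega
  · rw [key]
    have h1 := hb a l' _ h
    simp only [size_mk, N]
    omega

end

section
variable {α β γ δ : Type} [Enc α] [Enc β] [Enc γ] [Enc δ]

/-! ### Polynomial-time operations on truth values and lists -/

@[fun_prop]
theorem PolyTime.cond {c : α → Bool} {f g : α → β} (hc : PolyTime c) (hf : PolyTime f)
    (hg : PolyTime g) : PolyTime fun a => bif c a then f a else g a := by
  simpa only [Bool.cond_eq_ite] using hc.ite hf hg

@[fun_prop]
theorem PolyTime.and {f g : α → Bool} (hf : PolyTime f) (hg : PolyTime g) :
    PolyTime fun a => f a && g a := by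
  have : (fun a => f a && g a) = fun a => bif f a then g a else false := by
    funext a; cases f a <;> rfl
  rw [this]
  fun_prop

@[fun_prop]
theorem PolyTime.or {f g : α → Bool} (hf : PolyTime f) (hg : PolyTime g) :
    PolyTime fun a => f a || g a := by
  have : (fun a => f a || g a) = fun a => bif f a then true else g a := by
    funext a; cases f a <;> rfl
  rw [this]
  fun_prop

@[fun_prop]
theorem PolyTime.not {f : α → Bool} (hf : PolyTime f) : PolyTime fun a => !(f a) := by
  have : (fun a => !(f a)) = fun a => bif f a then false else true := by
    funext a; cases f a <;> rfl
  rw [this]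
  fun_prop

@[fun_prop]
theorem PolyTime.xor {f g : α → Bool} (hf : PolyTime f) (hg : PolyTime g) :
    PolyTime fun a => f a ^^ g a := by
  have : (fun a => f a ^^ g a) = fun a => bif f a then !(g a) else g a := by
    funext a; cases f a <;> cases g a <;> rfl
  rw [this]
  fun_prop

theorem PolyTime.list_isEmpty : PolyTime (List.isEmpty : List α → Bool) := by
  refine (PolyTime.id.list_casesOn (.const true) (g := fun _ _ _ => false) (.const _)).of_enc_eq ?_
  intro l; cases l <;> rfl

theorem PolyTime.list_tail : PolyTime (List.tail : List α → List α) := by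
  refine (PolyTime.id.list_casesOn (.const []) (g := fun _ _ t => t) (by fun_prop)).of_enc_eq ?_
  intro l; cases l <;> rfl

@[fun_prop]
theorem PolyTime.list_headD {l : α → List β} {d : α → β} (hl : PolyTime l) (hd : PolyTime d) :
    PolyTime fun a => (l a).headD (d a) := by
  refine (hl.list_casesOn hd (g := fun _ x _ => x) (by fun_prop)).of_enc_eq ?_
  intro a
  cases l a <;> rfl

attribute [fun_prop] PolyTime.list_isEmpty PolyTime.list_tail

theorem size_mem_le {l : List α} {x : α} (h : x ∈ l) : size x + 1 ≤ size l := by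
  induction l with
  | nil => simp at h
  | cons y l ih =>
    have := size_pos y
    have := size_pos l
    rw [size_cons]
    rcases List.mem_cons.1 h with rfl | h
    · omega
    · have := ih h
      omega

/-- Iteration over a list is possible in polynomial time if each round only adds to the size of
the state a number of tokens that does not depend on the state. -/
theorem PolyTime.foldl_of_size_le {init : α → γ} {l : α → List β} {step : α → γ → β → γ}
    (hinit : PolyTime init) (hl : PolyTime l)
    (hstep : PolyTime fun x : α × γ × β => step x.1 x.2.1 x.2.2)
    {g : α × β → ℕ} (hg : PolyBd g) (hs : ∀ a s x, size (step a s x) ≤ size s + g (a, x)) :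
    PolyTime fun a => (l a).foldl (step a) (init a) := by
  obtain ⟨q, hq⟩ := hg
  refine PolyTime.foldl hinit hl hstep
    (hinit.size_bd.add (hl.size_bd.mul (PolyBd.eval q (PolyBd.size.add hl.size_bd)))) ?_
  intro a l' l'' h
  have hx : ∀ x ∈ l a, g (a, x) ≤ q.eval (size a + size (l a)) := fun x hx => by
    refine (hq _).trans (polynomial_eval_mono q ?_)
    have := size_mem_le hx
    rw [size_mk]
    omega
  have : ∀ l' : List β, (∀ x ∈ l', g (a, x) ≤ q.eval (size a + size (l a))) → ∀ s,
      size (l'.foldl (step a) s) ≤ size s + l'.length * q.eval (size a + size (l a)) := by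
    intro l' h s
    induction l' generalizing s with
    | nil => simp
    | cons x l' ih =>
      have h1 := ih (fun y hy => h y (by simp [hy])) (step a s x)
      have h2 := hs a s x
      have h3 := h x (by simp)
      simp only [List.foldl_cons, List.length_cons, add_mul]
      omega
  refine (this l' (fun x hx' => hx x (by simp [h, hx'])) (init a)).trans ?_
  gcongr
  refine (List.length_le_size _).trans ?_
  have := size_append l' l''
  have := size_pos l''
  rw [← h] at *
  omega

@[fun_prop]
theorem PolyTime.list_reverse {l : α → List β} (hl : PolyTime l) :
    PolyTime fun a => (l a).reverse := by
  have := PolyTime.foldl_of_size_le (init := fun _ : α => ([] : List β)) (step := fun _ t x => x :: t)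
    (.const []) hl (by fun_prop) (PolyTime.size_bd (f := fun x : α × List β => x) .id |>.comp
      (f := fun x : α × β => (x.1, [x.2])) (PolyTime.size_bd (by fun_prop)))
      (fun a s x => by simp only [size_cons, size_mk]; omega)
  simpa [List.foldl_flip_cons_eq_append] using this

theorem PolyTime.foldr {init : α → γ} {l : α → List β} {step : α → β → γ → γ}
    (hinit : PolyTime init) (hl : PolyTime l)
    (hstep : PolyTime fun x : α × β × γ => step x.1 x.2.1 x.2.2)
    {B : α → ℕ} (hB : PolyBd B)
    (hb : ∀ a l' l'', l a = l' ++ l'' → size (l''.foldr (step a) (init a)) ≤ B a) :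
    PolyTime fun a => (l a).foldr (step a) (init a) := by
  have := PolyTime.foldl (step := fun a s x => step a x s) hinit hl.list_reverse
    (hstep.comp (f := fun x : α × γ × β => (x.1, x.2.2, x.2.1)) (by fun_prop)) hB
    (fun a l' l'' h => by
      have := hb a l''.reverse l'.reverse (by rw [← List.reverse_append, ← h, List.reverse_reverse])
      rwa [List.foldr_reverse] at this)
  simpa using this

theorem PolyTime.foldr_of_size_le {init : α → γ} {l : α → List β} {step : α → β → γ → γ}
    (hinit : PolyTime init) (hl : PolyTime l)
    (hstep : PolyTime fun x : α × β × γ => step x.1 x.2.1 x.2.2)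
    {g : α × β → ℕ} (hg : PolyBd g) (hs : ∀ a s x, size (step a x s) ≤ size s + g (a, x)) :
    PolyTime fun a => (l a).foldr (step a) (init a) := by
  have := PolyTime.foldl_of_size_le (step := fun a s x => step a x s) hinit hl.list_reverse
    (hstep.comp (f := fun x : α × γ × β => (x.1, x.2.2, x.2.1)) (by fun_prop)) hg hs
  simpa using this

@[fun_prop]
theorem PolyTime.list_map {l : α → List β} {f : α → β → γ} (hl : PolyTime l)
    (hf : PolyTime fun x : α × β => f x.1 x.2) : PolyTime fun a => (l a).map (f a) := by
  have := PolyTime.foldr_of_size_le (init := fun _ : α => ([] : List γ))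
    (step := fun a x t => f a x :: t) (.const []) hl
    ((hf.comp (f := fun x : α × β × List γ => (x.1, x.2.1)) (by fun_prop)).list_cons (by fun_prop))
    (hf.size_bd.add (.const 1)) (fun a s x => by simp only [size_cons]; omega)
  simpa [List.foldr_cons_eq_append] using this

@[fun_prop]
theorem PolyTime.list_append {l l' : α → List β} (hl : PolyTime l) (hl' : PolyTime l') :
    PolyTime fun a => l a ++ l' a := by
  have := PolyTime.foldr_of_size_le (init := l') (step := fun (_ : α) x t => x :: t) hl' hl
    (by fun_prop) ((PolyTime.size_bd (f := fun x : α × β => x.2) (by fun_prop)).add (.const 1))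
    (fun a s x => by simp only [size_cons]; omega)
  simpa using this

@[fun_prop]
theorem PolyTime.list_flatten {l : α → List (List β)} (hl : PolyTime l) :
    PolyTime fun a => (l a).flatten := by
  have := PolyTime.foldr_of_size_le (init := fun _ : α => ([] : List β))
    (step := fun (_ : α) x t => x ++ t) (.const []) hl (by fun_prop)
    (PolyTime.size_bd (f := fun x : α × List β => x.2) (by fun_prop))
    (fun a s x => by have := size_append x s; dsimp only; omega)
  refine this.of_enc_eq fun a => congrArg enc ?_
  induction l a with
  | nil => rfl
  | cons x t ih => simp [ih]

@[fun_prop]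
theorem PolyTime.list_filter {l : α → List β} {p : α → β → Bool} (hl : PolyTime l)
    (hp : PolyTime fun x : α × β => p x.1 x.2) : PolyTime fun a => (l a).filter (p a) := by
  have := (hl.list_map (f := fun a x => bif p a x then [x] else [])
    (hp.cond (by fun_prop) (by fun_prop))).list_flatten
  refine this.of_enc_eq fun a => congrArg enc ?_
  induction l a with
  | nil => rfl
  | cons x t ih => cases h : p a x <;> simp [h, ih]

theorem size_bool (b : Bool) : size b = 5 := by cases b <;> rfl

@[fun_prop]
theorem PolyTime.list_any {l : α → List β} {p : α → β → Bool} (hl : PolyTime l)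
    (hp : PolyTime fun x : α × β => p x.1 x.2) : PolyTime fun a => (l a).any (p a) := by
  have : PolyTime fun a => !((l a).filter (p a)).isEmpty := by fun_prop
  refine this.of_enc_eq fun a => congrArg enc ?_
  induction l a with
  | nil => rfl
  | cons x t ih => cases h : p a x <;> simp [h, ← ih]

@[fun_prop]
theorem PolyTime.list_all {l : α → List β} {p : α → β → Bool} (hl : PolyTime l)
    (hp : PolyTime fun x : α × β => p x.1 x.2) : PolyTime fun a => (l a).all (p a) := by
  have : PolyTime fun a => !(l a).any fun x => !p a x := by fun_prop
  refine this.of_enc_eq fun a => congrArg enc ?_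
  induction l a with
  | nil => rfl
  | cons x t ih => cases h : p a x <;> simp [h, ← ih]

@[fun_prop]
theorem PolyTime.option_isNone {o : α → Option β} (ho : PolyTime o) :
    PolyTime fun a => (o a).isNone := by
  have h1 : PolyTime fun a => (o a).toList := ho.of_enc_eq fun _ => rfl
  have h2 : PolyTime fun a => (o a).toList.isEmpty := by fun_prop
  exact h2.of_enc_eq fun a => by cases o a <;> rfl

@[fun_prop]
theorem PolyTime.option_getD {o : α → Option β} {d : α → β} (ho : PolyTime o) (hd : PolyTime d) :
    PolyTime fun a => (o a).getD (d a) := by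
  have h1 : PolyTime fun a => (o a).toList := ho.of_enc_eq fun _ => rfl
  have h2 : PolyTime fun a => (o a).toList.headD (d a) := by fun_prop
  exact h2.of_enc_eq fun a => by cases o a <;> rfl

/-! ### Polynomial-time arithmetic on binary numbers -/

theorem size_list_bool (l : List Bool) : size l = 6 * l.length + 1 := by
  induction l with
  | nil => rfl
  | cons b l ih => rw [size_cons, size_bool, ih, List.length_cons]; ring

theorem size_nat (n : ℕ) : size n = 6 * n.size + 1 := by
  rw [← Nat.size_eq_bits_len, ← size_list_bool]
  rfl

theorem size_add_nat_le (x y : ℕ) : size (x + y) ≤ size x + size y := by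
  rw [size_nat, size_nat, size_nat]
  have : (x + y).size ≤ max x.size y.size + 1 := by
    rw [Nat.size_le]
    have h1 : x < 2 ^ max x.size y.size :=
      (Nat.lt_size_self x).trans_le (Nat.pow_le_pow_right (by norm_num) (le_max_left _ _))
    have h2 : y < 2 ^ max x.size y.size :=
      (Nat.lt_size_self y).trans_le (Nat.pow_le_pow_right (by norm_num) (le_max_right _ _))
    rw [pow_succ]
    omega
  rcases Nat.eq_zero_or_pos x with rfl | hx
  · simp
  rcases Nat.eq_zero_or_pos y with rfl | hy
  · simp
  have := Nat.size_pos.2 hx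
  have := Nat.size_pos.2 hy
  omega

theorem size_nat_le (n : ℕ) : size n ≤ 6 * n + 1 := by
  rw [size_nat]
  have : n.size ≤ n := Nat.size_le.2 Nat.lt_two_pow_self
  omega

theorem PolyTime.nat_bits {f : α → ℕ} (hf : PolyTime f) : PolyTime fun a => (f a).bits :=
  hf.of_enc_eq fun _ => rfl

theorem PolyTime.of_bits {f : α → ℕ} (hf : PolyTime fun a => (f a).bits) : PolyTime f :=
  hf.of_enc_eq fun _ => rfl

@[fun_prop]
theorem PolyTime.nat_div2 {f : α → ℕ} (hf : PolyTime f) : PolyTime fun a => (f a).div2 := by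
  refine PolyTime.of_bits ?_
  simpa only [Nat.div2_bits_eq_tail] using PolyTime.list_tail.comp hf.nat_bits

@[fun_prop]
theorem PolyTime.nat_bodd {f : α → ℕ} (hf : PolyTime f) : PolyTime fun a => (f a).bodd := by
  have : PolyTime fun a => (f a).bits.headD false := hf.nat_bits.list_headD (.const false)
  refine this.of_enc_eq fun a => ?_
  rw [Nat.bodd_eq_bits_head]
  cases (f a).bits <;> rfl

@[fun_prop]
theorem PolyTime.nat_eq_zero {f : α → ℕ} (hf : PolyTime f) : PolyTime fun a => decide (f a = 0) := by
  have : PolyTime fun a => (f a).bits.isEmpty := PolyTime.list_isEmpty.comp hf.nat_bits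
  refine this.of_enc_eq fun a => congrArg enc ?_
  rcases Nat.eq_zero_or_pos (f a) with h | h
  · simp [h]
  · have h1 : (f a).bits ≠ [] := by
      intro h'
      have := Nat.size_pos.2 h
      rw [← Nat.size_eq_bits_len, h'] at this
      simp at this
    simp [h.ne', h1]

/-- One round of the schoolbook addition: the state consists of the remaining parts of both
summands, the carry, and the bits found so far, the last one first. -/
def addStep (s : ℕ × ℕ × Bool × List Bool) : ℕ × ℕ × Bool × List Bool :=
  bif decide (s.1 = 0) && decide (s.2.1 = 0) && !s.2.2.1 then s else
    (s.1.div2, s.2.1.div2,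
      s.1.bodd && s.2.1.bodd || s.1.bodd && s.2.2.1 || s.2.1.bodd && s.2.2.1,
      (s.1.bodd ^^ s.2.1.bodd ^^ s.2.2.1) :: s.2.2.2)

theorem size_div2_le (x : ℕ) : x.div2.size ≤ x.size - 1 := by
  rw [Nat.size_le, Nat.div2_val]
  have := Nat.lt_size_self x
  rcases h : x.size with _ | n
  · rw [h] at this
    omega
  · rw [h, pow_succ] at this
    simp
    omega

theorem bits_of_eq {n : ℕ} {b : Bool} {k : ℕ} (hn : 0 < n) (h : n = 2 * k + b.toNat) :
    n.bits = b :: k.bits := by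
  have : n = Nat.bit b k := by rw [h]; cases b <;> rfl
  rw [this]
  apply Nat.bits_append_bit
  rintro rfl
  cases b
  · simp at h; omega
  · rfl

/-- After sufficiently many rounds of the addition, the bits of the sum have been found. The
lowest-bit-first representation stays without leading zeros, since a round only emits a bit as long
as the remaining sum is positive. -/
theorem foldl_addStep (l : List Bool) (x y : ℕ) (c : Bool) (acc : List Bool)
    (h : x.size + y.size + c.toNat ≤ l.length) :
    l.foldl (fun s _ => addStep s) (x, y, c, acc) =
      (0, 0, false, (x + y + c.toNat).bits.reverse ++ acc) := by
  induction l generalizing x y c acc with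
  | nil =>
    have hx : x = 0 := Nat.size_eq_zero.1 (by simp at h; omega)
    have hy : y = 0 := Nat.size_eq_zero.1 (by simp at h; omega)
    cases c
    · simp [hx, hy]
    · simp at h
  | cons _ l ih =>
    rw [List.foldl_cons]
    by_cases h0 : x = 0 ∧ y = 0 ∧ c = false
    · obtain ⟨rfl, rfl, rfl⟩ := h0
      have := ih 0 0 false acc (by simp)
      simpa [addStep] using this
    · have hs : addStep (x, y, c, acc) = (x.div2, y.div2,
          x.bodd && y.bodd || x.bodd && c || y.bodd && c, (x.bodd ^^ y.bodd ^^ c) :: acc) := by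
        simp only [addStep]
        have : (decide (x = 0) && decide (y = 0) && !c) = false := by
          rw [Bool.eq_false_iff]
          intro h1
          apply h0
          simpa [and_assoc] using h1
        rw [this]
        rfl
      have hx := Nat.bodd_add_div2 x
      have hy := Nat.bodd_add_div2 y
      have sx := size_div2_le x
      have sy := size_div2_le y
      have px := @Nat.size_pos x
      have py := @Nat.size_pos y
      rw [hs, ih]
      · have hn : 0 < x + y + c.toNat := by
          by_contra hn
          apply h0
          cases c <;> simp at hn ⊢ <;> omega
        rw [bits_of_eq (b := x.bodd ^^ y.bodd ^^ c) (k := x.div2 + y.div2 +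
          (x.bodd && y.bodd || x.bodd && c || y.bodd && c).toNat) hn]
        · simp
        · revert hx hy
          cases x.bodd <;> cases y.bodd <;> cases c <;> simp <;> omega
      · simp only [List.length_cons] at h
        have h0' : 0 < x ∨ 0 < y ∨ c = true := by
          by_contra hn
          apply h0
          cases c <;> simp at hn ⊢ <;> omega
        clear h0
        revert hx hy h h0'
        cases x.bodd <;> cases y.bodd <;> cases c <;> simp <;> omega

@[fun_prop]
theorem PolyTime.nat_add {f g : α → ℕ} (hf : PolyTime f) (hg : PolyTime g) :
    PolyTime fun a => f a + g a := by
  have hstep : PolyTime addStep := by unfold addStep; fun_prop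
  have h := PolyTime.foldl_of_size_le (init := fun a => (f a, g a, false, ([] : List Bool)))
    (l := fun a => (f a).bits ++ (g a).bits) (step := fun _ s _ => addStep s)
    (by fun_prop) (hf.nat_bits.list_append hg.nat_bits) (hstep.comp (by fun_prop))
    (g := fun _ => 6) (.const 6) (fun a s x => by
      obtain ⟨x, y, c, acc⟩ := s
      simp only [addStep]
      rw [Bool.cond_eq_ite]
      split_ifs
      · omega
      · have := size_div2_le x
        have := size_div2_le y
        simp only [size_mk, size_cons, size_bool, size_nat]
        omega)
  have h' : PolyTime fun a => (((f a).bits ++ (g a).bits).foldl (fun s _ => addStep s)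
      (f a, g a, false, ([] : List Bool))).2.2.2.reverse := by fun_prop
  refine PolyTime.of_bits (h'.of_enc_eq fun a => congrArg enc ?_)
  rw [foldl_addStep _ _ _ _ _ (by simp [Nat.size_eq_bits_len])]
  simp

/-- One round of the comparison of two numbers, from the lowest bit to the highest. -/
def leStep (s : ℕ × ℕ × Bool) : ℕ × ℕ × Bool :=
  (s.1.div2, s.2.1.div2, bif s.1.bodd ^^ s.2.1.bodd then s.2.1.bodd else s.2.2)

/-- The flag `r` is the answer in case the remaining, higher parts are equal. -/
theorem foldl_leStep (l : List Bool) (x y : ℕ) (r : Bool) (h : x.size + y.size ≤ l.length) :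
    (l.foldl (fun s _ => leStep s) (x, y, r)).2.2 = decide (x < y ∨ x = y ∧ r = true) := by
  induction l generalizing x y r with
  | nil =>
    have hx : x = 0 := Nat.size_eq_zero.1 (by simp at h; omega)
    have hy : y = 0 := Nat.size_eq_zero.1 (by simp at h; omega)
    simp [hx, hy]
  | cons _ l ih =>
    have hx := Nat.bodd_add_div2 x
    have hy := Nat.bodd_add_div2 y
    have sx := size_div2_le x
    have sy := size_div2_le y
    have px := @Nat.size_pos x
    have py := @Nat.size_pos y
    have h0 : x = 0 ∨ 0 < x := Nat.eq_zero_or_pos x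
    have h0' : y = 0 ∨ 0 < y := Nat.eq_zero_or_pos y
    have e0 : Nat.size 0 = 0 := Nat.size_zero
    rw [List.foldl_cons, leStep, ih]
    · revert hx hy
      cases x.bodd <;> cases y.bodd <;> cases r <;> rw [Bool.eq_iff_iff] <;> simp <;> omega
    · simp only [List.length_cons] at h ⊢
      rcases h0 with rfl | h0
      · rcases h0' with rfl | h0'
        · simp
        · have := py.2 h0'
          omega
      · have := px.2 h0
        omega

@[fun_prop]
theorem PolyTime.nat_le {f g : α → ℕ} (hf : PolyTime f) (hg : PolyTime g) :
    PolyTime fun a => decide (f a ≤ g a) := by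
  have hstep : PolyTime leStep := by unfold leStep; fun_prop
  have h := PolyTime.foldl_of_size_le (init := fun a => (f a, g a, true))
    (l := fun a => (f a).bits ++ (g a).bits) (step := fun _ s _ => leStep s)
    (by fun_prop) (hf.nat_bits.list_append hg.nat_bits) (hstep.comp (by fun_prop))
    (g := fun _ => 0) (.const 0) (fun a s x => by
      obtain ⟨x, y, c⟩ := s
      have := size_div2_le x
      have := size_div2_le y
      simp only [leStep, size_mk, size_bool, size_nat]
      omega)
  refine (PolyTime.snd (PolyTime.snd h)).of_enc_eq fun a => congrArg enc ?_
  rw [foldl_leStep _ _ _ _ (by simp [Nat.size_eq_bits_len])]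
  simp [le_iff_lt_or_eq]

@[fun_prop]
theorem PolyTime.nat_lt {f g : α → ℕ} (hf : PolyTime f) (hg : PolyTime g) :
    PolyTime fun a => decide (f a < g a) := by
  have : PolyTime fun a => !decide (g a ≤ f a) := by fun_prop
  exact this.of_enc_eq fun a => congrArg enc (by rw [Bool.eq_iff_iff]; simp)

@[fun_prop]
theorem PolyTime.nat_eq {f g : α → ℕ} (hf : PolyTime f) (hg : PolyTime g) :
    PolyTime fun a => decide (f a = g a) := by
  have : PolyTime fun a => decide (f a ≤ g a) && decide (g a ≤ f a) := by fun_prop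
  exact this.of_enc_eq fun a => congrArg enc (by simp [Nat.le_antisymm_iff])

@[fun_prop]
theorem PolyTime.nat_max {f g : α → ℕ} (hf : PolyTime f) (hg : PolyTime g) :
    PolyTime fun a => max (f a) (g a) := by
  have : PolyTime fun a => bif decide (f a ≤ g a) then g a else f a := by fun_prop
  exact this.of_enc_eq fun a => congrArg enc (by simp [max_def, Bool.cond_eq_ite])

/-- The number with a given list of binary digits, lowest digit first. -/
def ofBits (l : List Bool) : ℕ := l.foldr (fun b n => n + n + b.toNat) 0

@[fun_prop]
theorem PolyTime.bool_toNat {f : α → Bool} (hf : PolyTime f) : PolyTime fun a => (f a).toNat := by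
  have : PolyTime fun a => bif f a then 1 else 0 := by fun_prop
  exact this.of_enc_eq fun a => congrArg enc (by cases f a <;> rfl)

theorem size_add_self (x : ℕ) : size (x + x) ≤ size x + 6 := by
  rw [size_nat, size_nat]
  have : (x + x).size ≤ x.size + 1 := by
    rw [Nat.size_le, pow_succ]
    have := Nat.lt_size_self x
    omega
  omega

@[fun_prop]
theorem PolyTime.ofBits {f : α → List Bool} (hf : PolyTime f) : PolyTime fun a => ofBits (f a) := by
  refine PolyTime.foldr_of_size_le (step := fun _ b n => n + n + b.toNat) (.const 0) hf
    (by fun_prop) (g := fun _ => 13) (.const _) fun a s x => ?_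
  have h1 := size_add_nat_le (s + s) x.toNat
  have h2 := size_add_self s
  have h3 : size x.toNat ≤ 7 := by cases x <;> decide
  omega

@[fun_prop]
theorem PolyTime.nat_mul {f g : α → ℕ} (hf : PolyTime f) (hg : PolyTime g) :
    PolyTime fun a => f a * g a := by
  have h := PolyTime.foldr_of_size_le (l := fun a => (f a).bits)
    (step := fun a b n => n + n + bif b then g a else 0) (.const 0) hf.nat_bits
    (by fun_prop) (g := fun x : α × Bool => size (g x.1) + 7)
    ((PolyTime.size_bd (f := fun x : α × Bool => g x.1) (by fun_prop)).add (.const 7))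
    fun a s x => ?_
  · refine h.of_enc_eq fun a => congrArg enc ?_
    induction f a using Nat.binaryRec' with
    | zero => simp
    | bit b n hb ih =>
      rw [Nat.bits_append_bit _ _ hb, List.foldr_cons, ih]
      cases b <;> simp [Nat.bit] <;> ring
  · have h1 := size_add_nat_le (s + s) (bif x then g a else 0)
    have h2 := size_add_self s
    have h3 : size (bif x then g a else 0) ≤ size (g a) + 1 := by
      cases x
      · simp [size_nat]
      · simp
    dsimp only
    omega

@[fun_prop]
theorem PolyTime.list_sum {l : α → List ℕ} (hl : PolyTime l) : PolyTime fun a => (l a).sum := by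
  have := PolyTime.foldr_of_size_le (init := fun _ : α => 0)
    (step := fun (_ : α) (x : ℕ) n => x + n) (.const 0) hl (by fun_prop)
    (PolyTime.size_bd (f := fun x : α × ℕ => x.2) (by fun_prop))
    (fun a s x => by have := size_add_nat_le x s; dsimp only; omega)
  simpa [List.sum] using this

@[fun_prop]
theorem PolyTime.list_length {l : α → List β} (hl : PolyTime l) :
    PolyTime fun a => (l a).length := by
  have : PolyTime fun a => ((l a).map fun _ => 1).sum := by fun_prop
  exact this.of_enc_eq fun a => congrArg enc (by simp)

theorem size_list_le (l : List α) (n : ℕ) (h : ∀ x ∈ l, size x ≤ n) :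
    size l ≤ l.length * (n + 1) + 1 := by
  induction l with
  | nil => simp [size_nil]
  | cons x l ih =>
    have h1 := ih fun y hy => h y (by simp [hy])
    have h2 := h x (by simp)
    simp only [size_cons, List.length_cons, add_mul] at *
    omega

/-- The list `[0, …, n - 1]` is computed in polynomial time if `n` is given in unary, as the length
of a list. -/
@[fun_prop]
theorem PolyTime.list_range_length {l : α → List β} (hl : PolyTime l) :
    PolyTime fun a => List.range (l a).length := by
  have key : ∀ t : List β, t.foldr (fun _ r => 0 :: r.map fun i => i + 1) [] =
      List.range t.length := by
    intro t
    induction t with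
    | nil => rfl
    | cons x t ih => rw [List.foldr_cons, ih, List.length_cons, List.range_succ_eq_map]
  have := PolyTime.foldr (init := fun _ : α => ([] : List ℕ)) (l := l)
    (step := fun _ _ r => 0 :: r.map fun i => i + 1) (.const []) hl (by fun_prop)
    (((hl.size_bd.mul (((PolyBd.const 6).mul hl.size_bd).add (.const 2))).add (.const 1)))
    (fun a l' l'' h => by
      rw [key]
      have h1 := List.length_le_size (l a)
      have h2 : l''.length ≤ (l a).length := by rw [h]; simp
      refine (size_list_le _ (6 * size (l a) + 1) fun x hx => ?_).trans ?_
      · have := size_nat_le x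
        have := List.mem_range.1 hx
        omega
      · rw [List.length_range]
        gcongr
        omega)
  refine this.of_enc_eq fun a => congrArg enc (key _)

@[fun_prop]
theorem PolyTime.list_getD {l : α → List β} {i : α → ℕ} {d : α → β} (hl : PolyTime l)
    (hi : PolyTime i) (hd : PolyTime d) : PolyTime fun a => (l a).getD (i a) (d a) := by
  have h := PolyTime.foldl_of_size_le (init := fun a => (0, d a)) (l := l)
    (step := fun a (s : ℕ × β) x => (s.1 + 1, bif decide (s.1 = i a) then x else s.2))
    (by fun_prop) hl (by fun_prop) ((PolyTime.size_bd (f := fun x : α × β => x.2)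
      (by fun_prop)).add (.const 7)) fun a s x => ?_
  · have key : ∀ (a : α) (t : List β) (j : ℕ) (e : β), t.foldl (fun s x => (s.1 + 1,
        bif decide (s.1 = i a) then x else s.2)) (j, e) =
        (j + t.length, if i a < j then e else t.getD (i a - j) e) := by
      intro a t
      induction t with
      | nil => intro j e; simp
      | cons y t ih =>
        intro j e
        rw [List.foldl_cons, ih]
        rcases lt_trichotomy (i a) j with hj | hj | hj
        · simp [hj, hj.ne', show i a < j + 1 by omega]; omega
        · simp [hj]; omega
        · have : i a - j = (i a - (j + 1)) + 1 := by omega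
          rw [this]
          simp [hj.ne, show ¬ i a < j + 1 by omega, show ¬ i a < j by omega]
          omega
    refine (PolyTime.snd h).of_enc_eq fun a => congrArg enc ?_
    rw [key]
    simp
  · have h1 := size_add_nat_le s.1 1
    have h2 : size (1 : ℕ) = 7 := by decide
    have h3 : size (bif decide (s.1 = i a) then x else s.2) ≤ size x + size s.2 := by
      cases decide (s.1 = i a) <;> simp
    have h4 : size s = size s.1 + size s.2 + 1 := rfl
    simp only [size_mk]
    omega

end

/-! ### The algorithm -/

/-- For the candidates `0, …, m - 1` and `1 ≤ s ≤ m`, the number `m! / s`: this is the share that a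
voter who approves `s` candidates gives to each of them, in units of `1 / m!`. -/
def weight (cs : List ℕ) (s : ℕ) : ℕ :=
  cs.foldr (fun i w => (bif decide (i + 1 = s) then 1 else i + 1) * w) 1

/-- The number of approvals on a ballot. -/
def ballotSize (r : List Bool) : ℕ := (r.filter fun x => x).length

/-- The score of a candidate, in units of `1 / m!`. -/
def intScore (cs : List ℕ) (rows : List (List Bool)) (c : ℕ) : ℕ :=
  (rows.map fun r => bif r.getD c false then weight cs (ballotSize r) else 0).sum

/-- The sensible ways to treat a ballot `r` in favour of `a` and against `b`: pairs of a number of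
operations and of the resulting difference between the shares of `a` and `b`, in units of `1 / m!`
and increased by the original share of `b`. -/
def options : ApprovalOp → List ℕ → List Bool → ℕ → ℕ → List (ℕ × ℕ)
  | .add, cs, r, a, b =>
    bif r.getD a false then [(0, weight cs (ballotSize r))]
    else bif r.getD b false then [(0, 0), (1, weight cs (ballotSize r))]
    else [(0, 0), (1, weight cs (ballotSize r + 1))]
  | .remove, cs, r, a, b =>
    bif r.getD a false then
      (0, weight cs (ballotSize r)) ::
        ((List.range (r.filter fun x => x).length).map fun c =>
          ((List.range (r.filter fun x => x).length).filter fun j =>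
            decide (c + j = ballotSize r)).map fun j =>
              (c, weight cs j + bif r.getD b false then weight cs (ballotSize r) else 0)).flatten
    else bif r.getD b false then [(0, 0), (1, weight cs (ballotSize r))]
    else [(0, 0)]
  | .swap, cs, r, a, b =>
    bif r.getD a false then
      bif r.getD b false && decide (ballotSize r < cs.length) then
        [(0, weight cs (ballotSize r)), (1, weight cs (ballotSize r) + weight cs (ballotSize r))]
      else [(0, weight cs (ballotSize r))]
    else bif r.getD b false then
      [(0, 0), (1, weight cs (ballotSize r) + weight cs (ballotSize r))]
    else bif decide (ballotSize r = 0) then [(0, 0)]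
    else [(0, 0), (1, weight cs (ballotSize r))]

/-- The maximum of a list of numbers. -/
def maxOf (l : List ℕ) : ℕ := l.foldr max 0

/-- One round of the dynamic program: in the table `t` of pairs of a cost and the highest value
that is possible for this cost, take account of one more voter, whose options are `v`. -/
def tableStep (J : List ℕ) (v t : List (ℕ × ℕ)) : List (ℕ × ℕ) :=
  J.map fun j => (j, maxOf (t.map fun p => maxOf (v.map fun q =>
    bif decide (p.1 + q.1 ≤ j) then p.2 + q.2 else 0)))

/-- The table of the highest total values for all costs in `J`, if one option is chosen from each
list in `vs`. -/
def table (J : List ℕ) (vs : List (List (ℕ × ℕ))) : List (ℕ × ℕ) :=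
  vs.foldr (fun v t => tableStep J v t) (J.map fun j => (j, 0))

/-- Can the result be changed by improving `a` in comparison with `b`? Some winning committee has to
contain `b` but not `a`, and it has to be possible that `a` overtakes `b`, or at least draws level
if the score of `a` is lower at the beginning. -/
def canOvertake (op : ApprovalOp) (cs : List ℕ) (k B : ℕ) (rows : List (List Bool)) (a b : ℕ) :
    Bool :=
  !decide (a = b) &&
  decide ((cs.filter fun c => decide (intScore cs rows b < intScore cs rows c)).length < k) &&
  decide (k < (cs.filter fun c => decide (intScore cs rows a ≤ intScore cs rows c)).length) &&
  (table (List.range (true :: rows.flatten).length)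
    (rows.map fun r => options op cs r a b)).any fun p =>
      decide (p.1 ≤ B) && (decide (intScore cs rows b < p.2) ||
        decide (intScore cs rows b ≤ p.2) && decide (intScore cs rows a < intScore cs rows b))

/-- One round of the division of a word into blocks: the state consists of the blocks found and of
the bits of the current block, both in reverse order. -/
def blockStep (s : List (List Bool) × List Bool) (x : Option Bool) :
    List (List Bool) × List Bool :=
  bif x.isNone then (s.2.reverse :: s.1, []) else (s.1, x.getD false :: s.2)

/-- Divide a word into blocks; the second component is what follows the last separator. -/
def blocks (w : List (Option Bool)) : List (List Bool) × List Bool := w.foldl blockStep ([], [])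

/-- The test of an instance that is given by the blocks of its code. -/
def decideBlocks (op : ApprovalOp) (us kb Bb : List Bool) (rows : List (List Bool)) : Bool :=
  us.all (fun x => x) && kb.foldl (fun _ x => x) true && Bb.foldl (fun _ x => x) true &&
  rows.all (fun r => decide (r.length = us.length)) &&
  decide (1 ≤ ofBits kb) && decide (ofBits kb ≤ us.length) &&
  (List.range us.length).any fun a => (List.range us.length).any fun b =>
    canOvertake op (List.range us.length) (ofBits kb) (ofBits Bb) rows a b

/-- The decision procedure for the robustness radius problem. -/
def decideWord (op : ApprovalOp) (w : List (Option Bool)) : Bool :=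
  (blocks w).2.isEmpty && decide (3 ≤ (blocks w).1.length) &&
  decideBlocks op ((blocks w).1.reverse.headD []) ((blocks w).1.reverse.tail.headD [])
    ((blocks w).1.reverse.tail.tail.headD []) (blocks w).1.reverse.tail.tail.tail

/-! ### The algorithm takes polynomial time -/

section
variable {α : Type} [Enc α]

theorem size_mul_nat_le (x y : ℕ) : size (x * y) ≤ size x + size y := by
  rw [size_nat, size_nat, size_nat]
  have : (x * y).size ≤ x.size + y.size := by
    rw [Nat.size_le, pow_add]
    exact Nat.mul_lt_mul'' (Nat.lt_size_self x) (Nat.lt_size_self y)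
  omega

@[fun_prop]
theorem PolyTime.weight {cs : α → List ℕ} {s : α → ℕ} (hcs : PolyTime cs) (hs : PolyTime s) :
    PolyTime fun a => weight (cs a) (s a) := by
  refine PolyTime.foldr_of_size_le (init := fun _ : α => 1)
    (step := fun a i w => (bif decide (i + 1 = s a) then 1 else i + 1) * w) (.const 1) hcs
    (by fun_prop) (PolyTime.size_bd
      (f := fun x : α × ℕ => (bif decide (x.2 + 1 = s x.1) then 1 else x.2 + 1)) (by fun_prop))
    fun a w i => ?_
  have := size_mul_nat_le (bif decide (i + 1 = s a) then 1 else i + 1) w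
  dsimp only
  omega

@[fun_prop]
theorem PolyTime.ballotSize {r : α → List Bool} (hr : PolyTime r) :
    PolyTime fun a => ballotSize (r a) := by
  unfold SavRobustness.ballotSize
  fun_prop

@[fun_prop]
theorem PolyTime.intScore {cs : α → List ℕ} {rows : α → List (List Bool)} {c : α → ℕ}
    (hcs : PolyTime cs) (hrows : PolyTime rows) (hc : PolyTime c) :
    PolyTime fun a => intScore (cs a) (rows a) (c a) := by
  unfold SavRobustness.intScore
  fun_prop

@[fun_prop]
theorem PolyTime.options {cs : α → List ℕ} {r : α → List Bool} {a b : α → ℕ} (op : ApprovalOp)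
    (hcs : PolyTime cs) (hr : PolyTime r) (ha : PolyTime a) (hb : PolyTime b) :
    PolyTime fun x => options op (cs x) (r x) (a x) (b x) := by
  cases op <;> unfold SavRobustness.options <;> fun_prop

@[fun_prop]
theorem PolyTime.maxOf {l : α → List ℕ} (hl : PolyTime l) : PolyTime fun a => maxOf (l a) := by
  refine PolyTime.foldr_of_size_le (init := fun _ : α => 0) (step := fun _ x n => max x n)
    (.const 0) hl (by fun_prop) (PolyTime.size_bd (f := fun x : α × ℕ => x.2) (by fun_prop))
    fun a n x => ?_
  rcases max_choice x n with h | h <;> rw [h] <;> dsimp only <;> omega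

theorem maxOf_le {l : List ℕ} {n : ℕ} (h : ∀ x ∈ l, x ≤ n) : maxOf l ≤ n := by
  induction l with
  | nil => exact Nat.zero_le n
  | cons x l ih =>
    exact max_le (h x (by simp)) (ih fun y hy => h y (by simp [hy]))

theorem le_maxOf {l : List ℕ} {x : ℕ} (h : x ∈ l) : x ≤ maxOf l := by
  induction l with
  | nil => simp at h
  | cons y l ih =>
    rcases List.mem_cons.1 h with rfl | h
    · exact le_max_left _ _
    · exact (ih h).trans (le_max_right _ _)

theorem maxOf_eq_zero_or_mem (l : List ℕ) : maxOf l = 0 ∨ maxOf l ∈ l := by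
  induction l with
  | nil => exact .inl rfl
  | cons x l ih =>
    have : maxOf (x :: l) = max x (maxOf l) := rfl
    rcases max_choice x (maxOf l) with h | h <;> rw [this, h]
    · simp
    · rcases ih with ih | ih
      · exact .inl ih
      · exact .inr (by simp [ih])

/-- The numbers in the table grow at most linearly with the number of voters, so that they have
polynomially many bits. -/
theorem table_le (J : List ℕ) (vs : List (List (ℕ × ℕ))) (M : ℕ)
    (h : ∀ v ∈ vs, ∀ q ∈ v, q.2 ≤ M) : ∀ p ∈ table J vs, p.1 ∈ J ∧ p.2 ≤ vs.length * M := by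
  induction vs with
  | nil =>
    intro p hp
    obtain ⟨j, hj, rfl⟩ := List.mem_map.1 hp
    simpa using hj
  | cons v vs ih =>
    intro p hp
    obtain ⟨j, hj, rfl⟩ := List.mem_map.1 hp
    refine ⟨hj, maxOf_le fun x hx => ?_⟩
    obtain ⟨p, hp, rfl⟩ := List.mem_map.1 hx
    refine maxOf_le fun x hx => ?_
    obtain ⟨q, hq, rfl⟩ := List.mem_map.1 hx
    have h1 := (ih (fun v hv => h v (by simp [hv])) p hp).2
    have h2 := h v (by simp) q hq
    rw [List.length_cons, add_mul]
    cases decide (p.1 + q.1 ≤ j)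
    · simp
    · simp only [cond_true]
      omega

theorem length_table (J : List ℕ) (vs : List (List (ℕ × ℕ))) : (table J vs).length = J.length := by
  cases vs <;> simp [table, tableStep]

@[fun_prop]
theorem PolyTime.table {J : α → List ℕ} {vs : α → List (List (ℕ × ℕ))} (hJ : PolyTime J)
    (hvs : PolyTime vs) : PolyTime fun a => table (J a) (vs a) := by
  refine PolyTime.foldr (init := fun a => (J a).map fun j => (j, 0))
    (step := fun a v t => tableStep (J a) v t) (by fun_prop) hvs
    (by unfold tableStep; fun_prop)
    ((hJ.size_bd.mul ((hJ.size_bd.add ((PolyBd.const 12).mul hvs.size_bd)).add (.const 3))).add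
      (.const 1)) fun a l' l'' h => ?_
  change size (SavRobustness.table (J a) l'') ≤ _
  -- every number in a list is less than a power of two whose exponent is the size of the list
  have hM : ∀ v ∈ l'', ∀ q ∈ v, q.2 ≤ 2 ^ size (vs a) := fun v hv q hq => by
    have h1 := size_mem_le hq
    have h2 : v ∈ vs a := by rw [h]; simp [hv]
    have h3 := size_mem_le h2
    have h4 : size q = size q.1 + size q.2 + 1 := rfl
    rw [size_nat q.2] at h4
    exact (Nat.lt_size_self q.2).le.trans (Nat.pow_le_pow_right (by norm_num) (by omega))
  have hl : l''.length ≤ size (vs a) := by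
    refine le_trans ?_ (List.length_le_size (vs a))
    rw [h]
    simp
  refine (size_list_le _ (size (J a) + 12 * size (vs a) + 2) fun p hp => ?_).trans ?_
  · obtain ⟨h1, h2⟩ := table_le _ _ _ hM p hp
    have h3 := size_mem_le h1
    have h4 : p.2.size ≤ size (vs a) + size (vs a) := by
      rw [Nat.size_le, pow_add]
      refine h2.trans_lt (Nat.mul_lt_mul_of_pos_right ?_ (by positivity))
      exact hl.trans_lt Nat.lt_two_pow_self
    have h5 : size p = size p.1 + size p.2 + 1 := rfl
    rw [size_nat p.2] at h5
    omega
  · rw [length_table]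
    have := List.length_le_size (J a)
    gcongr

@[fun_prop]
theorem PolyTime.canOvertake {cs : α → List ℕ} {k B : α → ℕ} {rows : α → List (List Bool)}
    {a b : α → ℕ} (op : ApprovalOp) (hcs : PolyTime cs) (hk : PolyTime k) (hB : PolyTime B)
    (hrows : PolyTime rows) (ha : PolyTime a) (hb : PolyTime b) :
    PolyTime fun x => canOvertake op (cs x) (k x) (B x) (rows x) (a x) (b x) := by
  unfold SavRobustness.canOvertake
  fun_prop

@[fun_prop]
theorem PolyTime.foldl_last {l : α → List Bool} (hl : PolyTime l) :
    PolyTime fun a => (l a).foldl (fun _ x => x) true :=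
  PolyTime.foldl_of_size_le (init := fun _ : α => true) (step := fun _ _ x => x) (.const true) hl
    (by fun_prop) (g := fun _ => 0) (.const 0) fun _ _ _ => by simp [size_bool]

@[fun_prop]
theorem PolyTime.decideBlocks {us kb Bb : α → List Bool} {rows : α → List (List Bool)}
    (op : ApprovalOp) (hus : PolyTime us) (hkb : PolyTime kb) (hBb : PolyTime Bb)
    (hrows : PolyTime rows) :
    PolyTime fun x => decideBlocks op (us x) (kb x) (Bb x) (rows x) := by
  unfold SavRobustness.decideBlocks
  fun_prop

@[fun_prop]
theorem PolyTime.blocks {w : α → List (Option Bool)} (hw : PolyTime w) :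
    PolyTime fun a => blocks (w a) := by
  refine PolyTime.foldl_of_size_le (init := fun _ : α => (([], []) : List (List Bool) × List Bool))
    (step := fun _ s x => blockStep s x) (.const _) hw (by unfold blockStep; fun_prop)
    (g := fun _ => 6) (.const 6) fun a s x => ?_
  obtain ⟨s, t⟩ := s
  cases x with
  | none =>
    simp only [blockStep, Option.isNone_none, cond_true, size_mk, size_cons, size_nil,
      size_list_bool, List.length_reverse]
    omega
  | some x =>
    simp only [blockStep, Option.isNone_some, cond_false, size_mk, size_cons, size_bool]
    omega

theorem PolyTime.decideWord (op : ApprovalOp) : PolyTime (decideWord op) := by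
  unfold SavRobustness.decideWord
  fun_prop

end

/-! ### Languages with a polynomial-time characteristic function -/

/-- Replace an input word on stack `0` by the tree that encodes it. -/
def readInput : Prog :=
  .seq (.loop 0 Option.isNone fun o => match o with
    | some x => .push 1 x
    | none => .skip)
  (.seq (.push 0 (some false)) (.loop 1 Option.isNone fun o => match o with
    | some x => .seq (pushData (enc x)) (.push 0 (some true))
    | none => .skip))

theorem size_option_bool_le (x : Option Bool) : (enc x).size ≤ 7 := by
  rcases x with _ | _ | _ <;> decide

theorem size_word_le (w : List (Option Bool)) : size w ≤ 8 * w.length + 1 := by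
  have := size_list_le w 7 fun x _ => size_option_bool_le x
  omega

theorem readInput_run (w : List (Option Bool)) :
    Within readInput (St w [] [] []) (St (enc w).ser [] [] []) (12 * w.length + 3) := by
  have h1 : ∀ w a : List Tok, Within (.loop 0 Option.isNone fun o => match o with
      | some x => .push 1 x
      | none => .skip) (St w a [] []) (St [] (w.reverse ++ a) [] []) (2 * w.length + 1) := by
    intro w
    induction w with
    | nil => exact fun a => Within.loop_exit rfl (by simp)
    | cons x w ih =>
      intro a
      refine Within.mono (Within.loop_step (o := some x) rfl rfl (Within.push
        (s' := St w (x :: a) [] []) (by simp)) (by simpa using ih (x :: a)))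
        (by simp only [List.length_cons]; omega)
  have h2 : ∀ w' w : List (Option Bool), Within (.loop 1 Option.isNone fun o => match o with
      | some x => .seq (pushData (enc x)) (.push 0 (some true))
      | none => .skip) (St (enc w).ser w' [] []) (St (enc (w'.reverse ++ w)).ser [] [] [])
      (9 * w'.length + 1) := by
    intro w'
    induction w' with
    | nil => exact fun w => Within.loop_exit rfl (by simp)
    | cons x w' ih =>
      intro w
      have h := size_option_bool_le x
      have hx : Within (.seq (pushData (enc x)) (.push 0 (some true)))
          (St (enc w).ser w' [] []) (St (enc (x :: w)).ser w' [] []) ((enc x).size + 1) := by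
        refine (pushData_run (enc x) (enc w).ser w' [] []).seq (Within.push ?_)
        simp [enc, encList, Data.ser]
      have hl := ih (x :: w)
      refine Within.mono (Within.loop_step (o := some x) (T := (enc x).size + 1) rfl rfl
        (s' := St (enc (x :: w)).ser w' [] []) (by simpa using hx) (by simpa using hl))
        (by simp only [List.length_cons]; omega)
  refine Within.mono ((h1 w []).seq (Within.seq (Within.push
    (s' := St (enc ([] : List (Option Bool))).ser w.reverse [] []) (by simp; rfl))
    (by simpa using h2 w.reverse []))) (by omega)

/-- Replace the code of a truth value on stack `0` by a single token. -/
def writeOutput : Prog :=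
  popThen (.case 0 fun o => popThen (popThen (popThen (.push 0 (o.getD none)))))

theorem writeOutput_run (b : Bool) :
    Within writeOutput (St (enc b).ser [] [] []) (St [some b] [] [] []) 6 := by
  have hp : ∀ x, Within (popThen (popThen (popThen (.push 0 x))))
      (St [some (!b), some false, some false] [] [] []) (St [x] [] [] []) 4 := fun x =>
    popThen_run (popThen_run (popThen_run (Within.push (by simp))))
  unfold writeOutput
  cases b
  all_goals
    refine Within.mono (popThen_run (Within.case_zero (T := 4) ?_)) (by norm_num)
    exact hp _

/-- A language is in P if its characteristic function is computed in polynomial time by a program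
on trees. -/
theorem inP_of_polyTime {L : Language (Option Bool)} {d : List (Option Bool) → Bool}
    (hd : PolyTime d) (h : ∀ w, d w = true ↔ w ∈ L) : InP L := by
  obtain ⟨p, T, ⟨q, hq⟩, hp⟩ := hd
  refine inP_of_run L (.seq readInput (.seq p writeOutput))
    (12 * .X + 3 + (q.comp (8 * .X + 1) + 6)) fun w => ?_
  have hT : T w ≤ q.eval (8 * w.length + 1) :=
    (hq w).trans (polynomial_eval_mono q (size_word_le w))
  have hr := (readInput_run w).seq (Within.seq (by simpa using hp w [] [] [])
    (writeOutput_run (d w)))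
  obtain ⟨t, ht, hr⟩ := hr
  have hs : ∀ l : List Tok, (fun k : Fin 4 => if k = 0 then l else []) = St l [] [] [] := by
    intro l
    funext k
    fin_cases k <;> rfl
  refine ⟨t, ?_, ?_⟩
  · simp
    omega
  · rw [hs, hs]
    convert hr using 4
    rw [Bool.eq_iff_iff]
    simp [h]

/-! ### Winning committees -/

section
variable {ι : Type} [DecidableEq ι]

/-- The committees of size `k` with the highest total score. -/
def winners (s : ι → ℚ) (k : ℕ) : Set (Finset ι) :=
  {S | S.card = k ∧ ∀ T : Finset ι, T.card = k → ∑ c ∈ T, s c ≤ ∑ c ∈ S, s c}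

theorem sum_insert_erase (s : ι → ℚ) {S : Finset ι} {x y : ι} (hx : x ∈ S) (hy : y ∉ S) :
    ∑ c ∈ insert y (S.erase x), s c = ∑ c ∈ S, s c - s x + s y := by
  rw [Finset.sum_insert (by simp [hy]), ← Finset.add_sum_erase S s hx]
  ring

theorem card_insert_erase {S : Finset ι} {x y : ι} (hx : x ∈ S) (hy : y ∉ S) :
    (insert y (S.erase x)).card = S.card := by
  rw [Finset.card_insert_of_notMem (by simp [hy]), Finset.card_erase_add_one hx]

theorem le_of_mem_winners {s : ι → ℚ} {k : ℕ} {S : Finset ι} (hS : S ∈ winners s k) {x y : ι}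
    (hx : x ∈ S) (hy : y ∉ S) : s y ≤ s x := by
  have := hS.2 (insert y (S.erase x)) (by rw [card_insert_erase hx hy, hS.1])
  rw [sum_insert_erase s hx hy] at this
  linarith

theorem insert_erase_mem_winners {s : ι → ℚ} {k : ℕ} {S : Finset ι} (hS : S ∈ winners s k)
    {x y : ι} (hx : x ∈ S) (hy : y ∉ S) (h : s x ≤ s y) : insert y (S.erase x) ∈ winners s k := by
  refine ⟨by rw [card_insert_erase hx hy, hS.1], fun T hT => ?_⟩
  have := hS.2 T hT
  rw [sum_insert_erase s hx hy]
  linarith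

/-- Only the elements outside of the intersection matter for the comparison of two committees. -/
theorem sum_le_sum_of_card_eq {s : ι → ℚ} {S T : Finset ι} (hc : S.card = T.card)
    (h : ∀ x ∈ S \ T, ∀ y ∈ T \ S, s x ≤ s y) : ∑ c ∈ S, s c ≤ ∑ c ∈ T, s c := by
  rw [← Finset.sum_inter_add_sum_sdiff S T s, ← Finset.sum_inter_add_sum_sdiff T S s,
    Finset.inter_comm]
  gcongr 1
  have hc' : (S \ T).card = (T \ S).card := by
    have h1 := Finset.card_inter_add_card_sdiff S T
    have h2 := Finset.card_inter_add_card_sdiff T S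
    rw [Finset.inter_comm] at h2
    omega
  rcases (S \ T).eq_empty_or_nonempty with h0 | h0
  · rw [h0, Finset.card_empty] at hc'
    rw [h0, Finset.card_eq_zero.1 hc'.symm]
  · obtain ⟨z, hz, hmax⟩ := (S \ T).exists_max_image s h0
    calc ∑ c ∈ S \ T, s c ≤ (S \ T).card • s z := Finset.sum_le_card_nsmul _ _ _ hmax
      _ = (T \ S).card • s z := by rw [hc']
      _ ≤ ∑ c ∈ T \ S, s c := Finset.card_nsmul_le_sum _ _ _ fun y hy => h z hz y hy

theorem mem_winners_of_le {s : ι → ℚ} {k : ℕ} {S : Finset ι} (hc : S.card = k)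
    (h : ∀ x ∈ S, ∀ y ∉ S, s y ≤ s x) : S ∈ winners s k := by
  refine ⟨hc, fun T hT => sum_le_sum_of_card_eq (hT.trans hc.symm) fun x hx y hy => ?_⟩
  simp only [Finset.mem_sdiff] at hx hy
  exact h y hy.1 x hx.2

theorem winners_nonempty {ι : Type} [Fintype ι] (s : ι → ℚ) {k : ℕ} (hk : k ≤ Fintype.card ι) :
    (winners s k).Nonempty := by
  have hne : (Finset.univ.powersetCard k : Finset (Finset ι)).Nonempty :=
    Finset.powersetCard_nonempty.2 hk
  obtain ⟨S, hS, hmax⟩ := Finset.exists_max_image _ (fun S => ∑ c ∈ S, s c) hne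
  exact ⟨S, (Finset.mem_powersetCard.1 hS).2, fun T hT =>
    hmax T (Finset.mem_powersetCard.2 ⟨Finset.subset_univ _, hT⟩)⟩

variable [Fintype ι]

/-- The family of winning committees changes if and only if, for some winning committee, a candidate
outside of it overtakes a member, or draws level with a member that had a higher score. -/
theorem winners_ne_iff {s s' : ι → ℚ} {k : ℕ} (hk : k ≤ Fintype.card ι) :
    winners s k ≠ winners s' k ↔ ∃ a b, (∃ S ∈ winners s k, b ∈ S ∧ a ∉ S) ∧
      (s' b < s' a ∨ s' b ≤ s' a ∧ s a < s b) := by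
  constructor
  · intro hne
    by_contra! hcon
    apply hne
    refine Set.Subset.antisymm (fun S hS => ?_) fun T hT => ?_
    · exact mem_winners_of_le hS.1 fun b hb a ha => (hcon a b ⟨S, hS, hb, ha⟩).1
    · obtain ⟨S, hS⟩ := winners_nonempty s hk
      refine ⟨hT.1, fun U hU => (hS.2 U hU).trans ?_⟩
      refine sum_le_sum_of_card_eq (hS.1.trans hT.1.symm) fun b hb a ha => ?_
      simp only [Finset.mem_sdiff] at ha hb
      exact (hcon a b ⟨S, hS, hb.1, ha.2⟩).2 (le_of_mem_winners hT ha.1 hb.2)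
  · rintro ⟨a, b, ⟨S, hS, hb, ha⟩, h⟩ heq
    have hS' : S ∈ winners s' k := heq ▸ hS
    have h1 := le_of_mem_winners hS' hb ha
    rcases h with h | ⟨h, hlt⟩
    · exact absurd h (not_lt.2 h1)
    · have h2 := insert_erase_mem_winners hS' hb ha h
      rw [← heq] at h2
      have := le_of_mem_winners h2 (Finset.mem_insert_self _ _)
        (show b ∉ insert a (S.erase b) by
          simp only [Finset.mem_insert, Finset.mem_erase, ne_eq, not_true, false_and, or_false]
          rintro rfl
          exact ha hb)
      exact absurd hlt (not_lt.2 this)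

/-- Some winning committee contains `b` but not `a` if and only if fewer than `k` candidates are
better than `b` and more than `k` candidates, `a` among them, are at least as good as `a`. -/
theorem exists_winner_iff {s : ι → ℚ} {k : ℕ} (hk : k ≤ Fintype.card ι) {a b : ι} (hab : a ≠ b) :
    (∃ S ∈ winners s k, b ∈ S ∧ a ∉ S) ↔
      (Finset.univ.filter fun c => s b < s c).card < k ∧
      k < (Finset.univ.filter fun c => s a ≤ s c).card := by
  constructor
  · rintro ⟨S, hS, hb, ha⟩
    constructor
    · rw [← hS.1, ← Finset.card_erase_add_one hb, Nat.lt_succ_iff]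
      refine Finset.card_le_card fun c hc => ?_
      rw [Finset.mem_filter] at hc
      refine Finset.mem_erase.2 ⟨by rintro rfl; exact lt_irrefl _ hc.2, ?_⟩
      by_contra h
      exact absurd hc.2 (not_lt.2 (le_of_mem_winners hS hb h))
    · rw [← hS.1, ← Nat.succ_le_iff, Nat.succ_eq_add_one, ← Finset.card_insert_of_notMem ha]
      refine Finset.card_le_card fun c hc => ?_
      rw [Finset.mem_filter]
      refine ⟨Finset.mem_univ _, ?_⟩
      rcases Finset.mem_insert.1 hc with rfl | hc
      · exact le_rfl
      · exact le_of_mem_winners hS hc ha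
  · rintro ⟨h1, h2⟩
    obtain ⟨S, hS, hb⟩ : ∃ S ∈ winners s k, b ∈ S := by
      obtain ⟨S, hS⟩ := winners_nonempty s hk
      by_cases hb : b ∈ S
      · exact ⟨S, hS, hb⟩
      rw [← hS.1] at h1
      obtain ⟨c, hc, hc'⟩ := Finset.exists_mem_notMem_of_card_lt_card h1
      refine ⟨_, insert_erase_mem_winners hS hc hb ?_, Finset.mem_insert_self _ _⟩
      simpa using hc'
    by_cases ha : a ∈ S
    · rw [← hS.1] at h2
      obtain ⟨c, hc, hc'⟩ := Finset.exists_mem_notMem_of_card_lt_card h2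
      rw [Finset.mem_filter] at hc
      refine ⟨_, insert_erase_mem_winners hS ha hc' hc.2, ?_, ?_⟩
      · simp [hb, hab.symm]
      · simp only [Finset.mem_insert, Finset.mem_erase, ne_eq, not_true, false_and, or_false]
        rintro rfl
        exact hc' ha
    · exact ⟨S, hS, hb, ha⟩

end

/-! ### Scores as integers -/

/-- The share of its point that a voter with approval set `A` gives to the candidate `c`. -/
def share {m : ℕ} (A : Finset (Fin m)) (c : Fin m) : ℚ := if c ∈ A then 1 / (A.card : ℚ) else 0

theorem savCandidateScore_eq_sum_share {m n : ℕ} (E : Election m n) (c : Fin m) :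
    savCandidateScore E c = ∑ v, share (E v) c := by
  rw [savCandidateScore, Finset.sum_filter]
  rfl

/-- The row of approval bits of a ballot. -/
def row {m : ℕ} (A : Finset (Fin m)) : List Bool := List.ofFn fun c : Fin m => decide (c ∈ A)

theorem getD_row {m : ℕ} (A : Finset (Fin m)) (c : Fin m) :
    (row A).getD c false = decide (c ∈ A) := by
  simp [row, List.getD_eq_getElem?_getD]

theorem length_filter_ofFn {m : ℕ} (p : Fin m → Bool) :
    ((List.ofFn p).filter fun x => x).length = (Finset.univ.filter fun c => p c = true).card := by
  induction m with
  | zero => simp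
  | succ m ih =>
    rw [List.ofFn_succ, Fin.card_filter_univ_succ]
    have := ih fun i => p i.succ
    cases h : p 0 <;> simp_all

theorem ballotSize_row {m : ℕ} (A : Finset (Fin m)) : ballotSize (row A) = A.card := by
  rw [ballotSize, row, length_filter_ofFn]
  simp

theorem length_filter_range {m : ℕ} (p : ℕ → Bool) :
    ((List.range m).filter p).length = (Finset.univ.filter fun c : Fin m => p c = true).card := by
  rw [← length_filter_ofFn (fun c : Fin m => p c)]
  have : List.ofFn (fun c : Fin m => p c) = (List.range m).map p := by
    apply List.ext_getElem <;> simp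
  rw [this, List.filter_map, List.length_map]
  rfl

theorem weight_eq_prod (m s : ℕ) :
    weight (List.range m) s = ∏ i ∈ Finset.range m, if i + 1 = s then 1 else i + 1 := by
  induction m with
  | zero => rfl
  | succ m ih =>
    rw [Finset.prod_range_succ, ← ih]
    have key : ∀ (l : List ℕ) (x : ℕ), l.foldr (fun i w => (bif decide (i + 1 = s) then 1
        else i + 1) * w) x = weight l s * x := by
      intro l x
      induction l with
      | nil => simp [weight]
      | cons i l ih => rw [List.foldr_cons, ih, ← mul_assoc]; rfl
    rw [List.range_succ, weight, List.foldr_append, key]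
    simp [Bool.cond_eq_ite]

/-- The product of all `i ≤ m` other than `s` is `m! / s`. -/
theorem weight_eq_div {m s : ℕ} (h1 : 1 ≤ s) (h2 : s ≤ m) :
    (weight (List.range m) s : ℚ) = m.factorial / s := by
  have hs : (s : ℚ) ≠ 0 := by positivity
  rw [eq_div_iff hs, ← Nat.cast_mul, Nat.cast_inj, weight_eq_prod,
    ← Finset.prod_range_add_one_eq_factorial]
  have hmem : s - 1 ∈ Finset.range m := Finset.mem_range.2 (by omega)
  rw [← Finset.mul_prod_erase _ _ hmem, ← Finset.mul_prod_erase _ (fun i => i + 1) hmem]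
  have : ∏ i ∈ (Finset.range m).erase (s - 1), (if i + 1 = s then 1 else i + 1) =
      ∏ i ∈ (Finset.range m).erase (s - 1), (i + 1) := by
    refine Finset.prod_congr rfl fun i hi => if_neg ?_
    have := Finset.ne_of_mem_erase hi
    omega
  rw [this, if_pos (by omega), one_mul, mul_comm]
  congr 1
  omega

theorem factorial_mul_share {m : ℕ} (A : Finset (Fin m)) (c : Fin m) :
    m.factorial * share A c = ((if c ∈ A then weight (List.range m) A.card else 0 : ℕ) : ℚ) := by
  unfold share
  split_ifs with h
  · rw [weight_eq_div (Finset.card_pos.2 ⟨c, h⟩) (by simpa using A.card_le_univ)]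
    ring
  · simp

/-- The ballots of an election as rows of bits. -/
def electionRows {m n : ℕ} (E : Election m n) : List (List Bool) := List.ofFn fun v => row (E v)

theorem intScore_eq {m n : ℕ} (E : Election m n) (c : Fin m) :
    (intScore (List.range m) (electionRows E) c : ℚ) = m.factorial * savCandidateScore E c := by
  rw [savCandidateScore_eq_sum_share, Finset.mul_sum, intScore, electionRows, List.map_ofFn,
    List.sum_ofFn, Nat.cast_sum]
  refine Finset.sum_congr rfl fun v _ => ?_
  rw [factorial_mul_share, Function.comp, getD_row, ballotSize_row, Bool.cond_decide]

theorem intScore_lt_iff {m n : ℕ} (E : Election m n) (a b : Fin m) :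
    intScore (List.range m) (electionRows E) a < intScore (List.range m) (electionRows E) b ↔
      savCandidateScore E a < savCandidateScore E b := by
  have hm : (0 : ℚ) < m.factorial := by positivity
  rw [← @Nat.cast_lt ℚ, intScore_eq, intScore_eq, mul_lt_mul_iff_right₀ hm]

/-! ### Operations on single ballots -/

section
variable {m : ℕ}

/-- A single operation on one ballot. -/
def BallotStep : ApprovalOp → Finset (Fin m) → Finset (Fin m) → Prop
  | .add, A, A' => ∃ c, c ∉ A ∧ A' = insert c A
  | .remove, A, A' => ∃ c, c ∈ A ∧ A' = A.erase c
  | .swap, A, A' => ∃ c d, c ∈ A ∧ d ∉ A ∧ A' = insert d (A.erase c)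

/-- A sequence of exactly `j` operations on one ballot. -/
def BallotSteps (op : ApprovalOp) : ℕ → Finset (Fin m) → Finset (Fin m) → Prop
  | 0, A, A' => A' = A
  | j + 1, A, A' => ∃ F, BallotStep op A F ∧ BallotSteps op j F A'

theorem BallotStep.steps {op : ApprovalOp} {A A' : Finset (Fin m)} (h : BallotStep op A A') :
    BallotSteps op 1 A A' := ⟨A', h, rfl⟩

theorem step_iff {op : ApprovalOp} {n : ℕ} {E E' : Election m n} :
    op.Step E E' ↔ ∃ v F, BallotStep op (E v) F ∧ E' = Function.update E v F := by
  cases op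
  · constructor
    · rintro ⟨v, c, h, rfl⟩
      exact ⟨v, _, ⟨c, h, rfl⟩, rfl⟩
    · rintro ⟨v, _, ⟨c, h, rfl⟩, rfl⟩
      exact ⟨v, c, h, rfl⟩
  · constructor
    · rintro ⟨v, c, h, rfl⟩
      exact ⟨v, _, ⟨c, h, rfl⟩, rfl⟩
    · rintro ⟨v, _, ⟨c, h, rfl⟩, rfl⟩
      exact ⟨v, c, h, rfl⟩
  · constructor
    · rintro ⟨v, c, d, h, h', rfl⟩
      exact ⟨v, _, ⟨c, d, h, h', rfl⟩, rfl⟩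
    · rintro ⟨v, _, ⟨c, d, h, h', rfl⟩, rfl⟩
      exact ⟨v, c, d, h, h', rfl⟩

/-- A sequence of operations on an election splits into sequences of operations on its ballots. -/
theorem steps_iff {op : ApprovalOp} {n j : ℕ} {E E' : Election m n} :
    op.Steps j E E' ↔ ∃ c : Fin n → ℕ, ∑ v, c v = j ∧ ∀ v, BallotSteps op (c v) (E v) (E' v) := by
  induction j generalizing E with
  | zero =>
    constructor
    · rintro rfl
      exact ⟨fun _ => 0, by simp, fun v => rfl⟩
    · rintro ⟨c, hc, h⟩
      have hc0 : ∀ v, c v = 0 := by simpa using hc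
      funext v
      have := h v
      rwa [hc0 v] at this
  | succ j ih =>
    constructor
    · rintro ⟨F, hF, hs⟩
      obtain ⟨v, G, hG, rfl⟩ := step_iff.1 hF
      obtain ⟨c, hc, h⟩ := ih.1 hs
      refine ⟨Function.update c v (c v + 1), ?_, fun u => ?_⟩
      · rw [Finset.sum_update_of_mem (Finset.mem_univ v), ← hc, Finset.sdiff_singleton_eq_erase,
          ← Finset.add_sum_erase _ c (Finset.mem_univ v)]
        ring
      · have := h u
        by_cases hu : u = v
        · subst hu
          rw [Function.update_self] at this ⊢
          exact ⟨G, hG, this⟩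
        · rwa [Function.update_of_ne hu] at this ⊢
    · rintro ⟨c, hc, h⟩
      obtain ⟨v, hv⟩ : ∃ v, c v ≠ 0 := by
        by_contra! h0
        simp [h0] at hc
      obtain ⟨i, hi⟩ := Nat.exists_eq_succ_of_ne_zero hv
      obtain ⟨G, hG, hs⟩ : ∃ G, BallotStep op (E v) G ∧ BallotSteps op i G (E' v) := by
        have := h v
        rwa [hi] at this
      refine ⟨_, step_iff.2 ⟨v, G, hG, rfl⟩, ih.2 ⟨Function.update c v i, ?_, fun u => ?_⟩⟩
      · rw [Finset.sum_update_of_mem (Finset.mem_univ v), Finset.sdiff_singleton_eq_erase]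
        rw [← Finset.add_sum_erase _ c (Finset.mem_univ v)] at hc
        omega
      · by_cases hu : u = v
        · subst hu
          rwa [Function.update_self, Function.update_self]
        · rw [Function.update_of_ne hu, Function.update_of_ne hu]
          exact h u

theorem BallotSteps.add_spec {j : ℕ} {A A' : Finset (Fin m)} (h : BallotSteps .add j A A') :
    A ⊆ A' ∧ A'.card = A.card + j := by
  induction j generalizing A with
  | zero => cases h; simp
  | succ j ih =>
    obtain ⟨F, ⟨c, hc, rfl⟩, h⟩ := h
    obtain ⟨h1, h2⟩ := ih h
    rw [Finset.card_insert_of_notMem hc] at h2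
    exact ⟨(Finset.subset_insert _ _).trans h1, by omega⟩

theorem BallotSteps.remove_spec {j : ℕ} {A A' : Finset (Fin m)} (h : BallotSteps .remove j A A') :
    A' ⊆ A ∧ A'.card + j = A.card := by
  induction j generalizing A with
  | zero => cases h; simp
  | succ j ih =>
    obtain ⟨F, ⟨c, hc, rfl⟩, h⟩ := h
    obtain ⟨h1, h2⟩ := ih h
    rw [← Finset.card_erase_add_one hc]
    exact ⟨h1.trans (Finset.erase_subset _ _), by omega⟩

theorem BallotSteps.swap_card {j : ℕ} {A A' : Finset (Fin m)} (h : BallotSteps .swap j A A') :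
    A'.card = A.card := by
  induction j generalizing A with
  | zero => cases h; rfl
  | succ j ih =>
    obtain ⟨F, ⟨c, d, hc, hd, rfl⟩, h⟩ := h
    rw [ih h, card_insert_erase hc hd]

theorem ballotSteps_remove {j : ℕ} {A A' : Finset (Fin m)} (h : A' ⊆ A)
    (hc : A'.card + j = A.card) : BallotSteps .remove j A A' := by
  induction j generalizing A with
  | zero => exact Finset.eq_of_subset_of_card_le h (by omega)
  | succ j ih =>
    obtain ⟨c, hc1, hc2⟩ := Finset.exists_mem_notMem_of_card_lt_card (s := A') (t := A) (by omega)
    refine ⟨_, ⟨c, hc1, rfl⟩, ih (fun x hx => Finset.mem_erase.2 ⟨?_, h hx⟩) ?_⟩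
    · rintro rfl
      exact hc2 hx
    · have := Finset.card_erase_add_one hc1
      omega

/-! ### The value of a changed ballot -/

/-- The difference of the shares of `a` and `b` on the ballot `A'`, in units of `1 / m!` and
increased by the share of `b` on the original ballot `A`. -/
def value (A A' : Finset (Fin m)) (a b : Fin m) : ℚ :=
  m.factorial * (share A' a - share A' b + share A b)

theorem value_self (A : Finset (Fin m)) (a b : Fin m) :
    value A A a b = if a ∈ A then (weight (List.range m) A.card : ℚ) else 0 := by
  rw [value, sub_add_cancel, factorial_mul_share]
  split_ifs <;> simp

theorem value_eq (A A' : Finset (Fin m)) (a b : Fin m) :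
    value A A' a b = (if a ∈ A' then (weight (List.range m) A'.card : ℚ) else 0) -
      (if b ∈ A' then (weight (List.range m) A'.card : ℚ) else 0) +
      (if b ∈ A then (weight (List.range m) A.card : ℚ) else 0) := by
  rw [value, mul_add, mul_sub, factorial_mul_share, factorial_mul_share, factorial_mul_share]
  split_ifs <;> simp

theorem weight_anti {i j : ℕ} (hi : 1 ≤ i) (hij : i ≤ j) (hj : j ≤ m) :
    (weight (List.range m) j : ℚ) ≤ weight (List.range m) i := by
  rw [weight_eq_div (hi.trans hij) hj, weight_eq_div hi (hij.trans hj)]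
  gcongr

/-- If `a` is approved, then the options for removals are to leave the ballot as it is, and to
remove any number of other approvals, among them the one of `b` if there is one. -/
theorem mem_options_remove_iff {A : Finset (Fin m)} {a b : Fin m} (ha : a ∈ A) {q : ℕ × ℕ} :
    q ∈ options .remove (List.range m) (row A) a b ↔
      q = (0, weight (List.range m) A.card) ∨ (1 ≤ q.1 ∧ q.1 < A.card ∧ q.2 = weight (List.range m) (A.card - q.1) +
          if b ∈ A then weight (List.range m) A.card else 0) := by
  have hlen : ((row A).filter fun x => x).length = A.card := ballotSize_row A
  simp only [options, getD_row, ballotSize_row, Bool.cond_decide, if_pos ha, hlen,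
    List.mem_cons, List.mem_flatten, List.mem_map, List.mem_filter, List.mem_range,
    decide_eq_true_eq, exists_exists_and_eq_and]
  refine or_congr Iff.rfl ⟨?_, ?_⟩
  · rintro ⟨c, hc, j, ⟨hj, hcj⟩, rfl⟩
    refine ⟨by dsimp only; omega, hc, ?_⟩
    rw [show A.card - c = j by omega]
  · rintro ⟨h1, h2, h3⟩
    exact ⟨q.1, h2, A.card - q.1, ⟨by omega, by omega⟩, Prod.ext rfl h3.symm⟩

/-- Every option can be realized. -/
theorem exists_ballot_of_mem_options (op : ApprovalOp) (A : Finset (Fin m)) {a b : Fin m}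
    (hab : a ≠ b) {q : ℕ × ℕ} (hq : q ∈ options op (List.range m) (row A) a b) :
    ∃ c ≤ q.1, ∃ A', BallotSteps op c A A' ∧ (q.2 : ℚ) ≤ value A A' a b := by
  -- options without any operation
  have hself : ∀ x : ℕ, x ≤ (if a ∈ A then weight (List.range m) A.card else 0) →
      ∃ c ≤ 0, ∃ A', BallotSteps op c A A' ∧ (x : ℚ) ≤ value A A' a b := fun x hx =>
    ⟨0, le_rfl, A, rfl, by rw [value_self]; exact_mod_cast hx⟩
  cases op
  -- additions
  · simp only [options, getD_row, ballotSize_row, Bool.cond_decide] at hq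
    split_ifs at hq with ha hb <;> simp only [List.mem_cons, List.not_mem_nil, or_false] at hq
    · subst hq
      exact hself _ (by simp [ha])
    · rcases hq with rfl | rfl
      · exact hself _ (by simp)
      · refine ⟨1, le_rfl, insert a A, BallotStep.steps ⟨a, ha, rfl⟩, ?_⟩
        simp [value_eq, hb]
    · rcases hq with rfl | rfl
      · exact hself _ (by simp)
      · refine ⟨1, le_rfl, insert a A, BallotStep.steps ⟨a, ha, rfl⟩, ?_⟩
        simp [value_eq, hb, hab.symm, ha]
  -- removals
  · by_cases ha : a ∈ A
    · rcases (mem_options_remove_iff ha).1 hq with rfl | ⟨hs, h1, h3⟩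
      · exact hself _ (by simp [ha])
      · obtain ⟨A', h4, h5, h6⟩ := Finset.exists_subsuperset_card_eq (s := {a}) (t := A.erase b)
          (n := A.card - q.1) (by simp [ha, hab]) (by simp; omega) (by
            have := Finset.pred_card_le_card_erase (s := A) (a := b)
            omega)
        have hb' : b ∉ A' := fun h => (Finset.mem_erase.1 (h5 h)).1 rfl
        refine ⟨q.1, le_rfl, A', ballotSteps_remove (h5.trans (Finset.erase_subset _ _))
          (by omega), ?_⟩
        rw [value_eq, h6, h3]
        simp only [Finset.singleton_subset_iff.1 h4, hb', if_true, if_false, Nat.cast_add]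
        split_ifs <;> simp
    · simp only [options, getD_row, ballotSize_row, Bool.cond_decide, if_neg ha] at hq
      split_ifs at hq with hb <;> simp only [List.mem_cons, List.not_mem_nil, or_false] at hq
      · rcases hq with rfl | rfl
        · exact hself _ (by simp)
        · refine ⟨1, le_rfl, A.erase b, BallotStep.steps ⟨b, hb, rfl⟩, ?_⟩
          simp [value_eq, ha, hb]
      · subst hq
        exact hself _ (by simp)
  -- swaps
  · simp only [options, getD_row, ballotSize_row, Bool.cond_eq_ite, Bool.and_eq_true,
      decide_eq_true_eq, List.length_range] at hq
    split_ifs at hq with ha hb hb h0 <;>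
      simp only [List.mem_cons, List.not_mem_nil, or_false] at hq
    · rcases hq with rfl | rfl
      · exact hself _ (by simp [ha])
      · obtain ⟨d, -, hd⟩ := Finset.exists_mem_notMem_of_card_lt_card (s := A)
          (t := Finset.univ) (by simpa using hb.2)
        refine ⟨1, le_rfl, _, BallotStep.steps ⟨b, d, hb.1, hd, rfl⟩, ?_⟩
        have hbd : b ≠ d := by
          rintro rfl
          exact hd hb.1
        rw [value_eq, card_insert_erase hb.1 hd]
        simp [ha, hab, hb.1, hbd]
    · subst hq
      exact hself _ (by simp [ha])
    · rcases hq with rfl | rfl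
      · exact hself _ (by simp)
      · refine ⟨1, le_rfl, _, BallotStep.steps ⟨b, a, hb, ha, rfl⟩, ?_⟩
        rw [value_eq, card_insert_erase hb ha]
        simp [hab.symm, hb]
    · subst hq
      exact hself _ (by simp)
    · rcases hq with rfl | rfl
      · exact hself _ (by simp)
      · obtain ⟨c, hc⟩ := Finset.card_pos.1 (Nat.pos_of_ne_zero h0)
        refine ⟨1, le_rfl, _, BallotStep.steps ⟨c, a, hc, ha, rfl⟩, ?_⟩
        rw [value_eq, card_insert_erase hc ha]
        simp [hab.symm, hb]

/-- No sequence of operations on a ballot is better than all options that are not more costly. -/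
theorem exists_option_of_ballotSteps {op : ApprovalOp} {A A' : Finset (Fin m)} {a b : Fin m}
    {c : ℕ} (h : BallotSteps op c A A') :
    ∃ q ∈ options op (List.range m) (row A) a b, q.1 ≤ c ∧ value A A' a b ≤ q.2 := by
  have hm : A.card ≤ m := by simpa using A.card_le_univ
  have hm' : A'.card ≤ m := by simpa using A'.card_le_univ
  have hw : ∀ s, (0 : ℚ) ≤ weight (List.range m) s := fun s => Nat.cast_nonneg _
  have hself : A' = A → value A A' a b =
      ((if a ∈ A then weight (List.range m) A.card else 0 : ℕ) : ℚ) := by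
    rintro rfl
    rw [value_self]
    push_cast
    rfl
  have hval := value_eq A A' a b
  cases op
  -- additions
  · obtain ⟨h1, h2⟩ := h.add_spec
    simp only [options, getD_row, ballotSize_row, Bool.cond_decide]
    by_cases ha : a ∈ A
    · have hpos := Finset.card_pos.2 ⟨a, ha⟩
      have := weight_anti hpos (Finset.card_le_card h1) hm'
      refine ⟨_, by rw [if_pos ha]; exact List.mem_singleton_self _, Nat.zero_le _, ?_⟩
      rw [hval, if_pos (h1 ha)]
      by_cases hb : b ∈ A
      · rw [if_pos (h1 hb), if_pos hb]
        simp
      · rw [if_neg hb]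
        have := hw A'.card
        split_ifs <;> linarith
    · rcases Nat.eq_zero_or_pos c with rfl | hc
      · refine ⟨(0, 0), by rw [if_neg ha]; split_ifs <;> simp, le_rfl, ?_⟩
        rw [hself h, if_neg ha]
      · by_cases hb : b ∈ A
        · refine ⟨(1, weight (List.range m) A.card), by simp [ha, hb], hc, ?_⟩
          rw [hval, if_pos (h1 hb), if_pos hb]
          have := hw A'.card
          split_ifs <;> simp [this]
        · refine ⟨(1, weight (List.range m) (A.card + 1)), by simp [ha, hb], hc, ?_⟩
          have := weight_anti (i := A.card + 1) (j := A'.card) (by omega) (by omega) hm'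
          have := hw A'.card
          have := hw (A.card + 1)
          rw [hval, if_neg hb]
          split_ifs <;> linarith
  -- removals
  · obtain ⟨h1, h2⟩ := h.remove_spec
    by_cases ha : a ∈ A
    · by_cases hc : 1 ≤ c ∧ a ∈ A'
      · have hpos := Finset.card_pos.2 ⟨a, hc.2⟩
        refine ⟨(c, weight (List.range m) (A.card - c) + if b ∈ A then
          weight (List.range m) A.card else 0), (mem_options_remove_iff ha).2 (.inr ⟨hc.1,
          by dsimp only; omega, rfl⟩), le_rfl, ?_⟩
        have := hw A'.card
        rw [hval, show A.card - c = A'.card by omega, Nat.cast_add, Nat.cast_ite, Nat.cast_zero]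
        split_ifs <;> linarith
      · refine ⟨_, (mem_options_remove_iff ha).2 (.inl rfl), Nat.zero_le _, ?_⟩
        rcases Nat.eq_zero_or_pos c with rfl | hc0
        · rw [hself h, if_pos ha]
        · rw [hval, if_neg (fun h => hc ⟨hc0, h⟩)]
          have := hw A'.card
          have := hw A.card
          dsimp only
          split_ifs <;> linarith
    · have ha' : a ∉ A' := fun h => ha (h1 h)
      simp only [options, getD_row, ballotSize_row, Bool.cond_decide, if_neg ha]
      rcases Nat.eq_zero_or_pos c with rfl | hc
      · refine ⟨(0, 0), by split_ifs <;> simp, le_rfl, ?_⟩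
        rw [hself h, if_neg ha]
      · by_cases hb : b ∈ A
        · refine ⟨(1, weight (List.range m) A.card), by simp [hb], hc, ?_⟩
          rw [hval, if_neg ha', if_pos hb]
          have := hw A'.card
          dsimp only
          split_ifs <;> linarith
        · refine ⟨(0, 0), by simp [hb], hc.le, ?_⟩
          rw [hval, if_neg ha', if_neg hb, if_neg (fun h => hb (h1 h))]
          simp
  -- swaps
  · have h2 := h.swap_card
    have hle : value A A' a b ≤ weight (List.range m) A.card +
        if b ∈ A then (weight (List.range m) A.card : ℚ) else 0 := by
      rw [hval, h2]
      have := hw A.card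
      split_ifs <;> linarith
    simp only [options, getD_row, ballotSize_row, Bool.cond_eq_ite, Bool.and_eq_true,
      decide_eq_true_eq, List.length_range]
    rcases Nat.eq_zero_or_pos c with rfl | hc
    · by_cases ha : a ∈ A
      · refine ⟨(0, weight (List.range m) A.card), by rw [if_pos ha]; split_ifs <;> simp,
          le_rfl, ?_⟩
        rw [hself h, if_pos ha]
      · refine ⟨(0, 0), by rw [if_neg ha]; split_ifs <;> simp, le_rfl, ?_⟩
        rw [hself h, if_neg ha]
    · by_cases hb : b ∈ A
      · rw [if_pos hb] at hle
        by_cases ha : a ∈ A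
        · by_cases hlt : A.card < m
          · refine ⟨(1, weight (List.range m) A.card + weight (List.range m) A.card),
              by simp [ha, hb, hlt], hc, ?_⟩
            exact_mod_cast hle
          · -- all candidates are approved, so that no swap is possible
            have hA : A = Finset.univ := by
              rw [← Finset.card_eq_iff_eq_univ, Fintype.card_fin]
              omega
            have hA' : A' = Finset.univ := by
              rw [← Finset.card_eq_iff_eq_univ, Fintype.card_fin]
              omega
            refine ⟨(0, weight (List.range m) A.card), by simp [ha, hlt], Nat.zero_le _, ?_⟩
            rw [hself (hA'.trans hA.symm), if_pos ha]
        · refine ⟨(1, weight (List.range m) A.card + weight (List.range m) A.card),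
            by simp [ha, hb], hc, ?_⟩
          exact_mod_cast hle
      · rw [if_neg hb, add_zero] at hle
        by_cases ha : a ∈ A
        · refine ⟨(0, weight (List.range m) A.card), by simp [ha, hb], Nat.zero_le _, hle⟩
        · by_cases h0 : A.card = 0
          · refine ⟨(0, 0), by simp [ha, hb, h0], Nat.zero_le _, ?_⟩
            have hA' : A' = A := by
              rw [h0, Finset.card_eq_zero] at h2
              rw [h2, Finset.card_eq_zero.1 h0]
            rw [hself hA', if_neg ha]
          · exact ⟨(1, weight (List.range m) A.card), by simp [ha, hb, h0], hc, hle⟩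

theorem cost_le_of_mem_options {op : ApprovalOp} {A : Finset (Fin m)} {a b : Fin m} {q : ℕ × ℕ}
    (hq : q ∈ options op (List.range m) (row A) a b) : q.1 ≤ m := by
  have hm : A.card ≤ m := by simpa using A.card_le_univ
  have hm' : 1 ≤ m := Nat.one_le_iff_ne_zero.2 (by rintro rfl; exact a.elim0)
  by_cases h : op = .remove ∧ a ∈ A
  · obtain ⟨rfl, ha⟩ := h
    rcases (mem_options_remove_iff ha).1 hq with rfl | ⟨_, h3, _⟩
    · exact Nat.zero_le _
    · omega
  · have : ∀ x y z : ℕ, q ∈ [(0, x)] ∨ q ∈ [(0, y), (1, z)] → q.1 ≤ m := by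
      intro x y z hq
      simp only [List.mem_cons, List.not_mem_nil, or_false] at hq
      rcases hq with rfl | rfl | rfl
      · exact Nat.zero_le _
      · exact Nat.zero_le _
      · exact hm'
    cases op <;> simp only [options, getD_row, ballotSize_row, Bool.cond_eq_ite,
      decide_eq_true_eq, true_and] at hq h
    · split_ifs at hq
      · exact this _ 0 0 (.inl hq)
      · exact this 0 _ _ (.inr hq)
      · exact this 0 _ _ (.inr hq)
    · rw [if_neg h] at hq
      split_ifs at hq
      · exact this 0 _ _ (.inr hq)
      · exact this _ 0 0 (.inl hq)
    · split_ifs at hq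
      · exact this 0 _ _ (.inr hq)
      · exact this _ 0 0 (.inl hq)
      · exact this 0 _ _ (.inr hq)
      · exact this _ 0 0 (.inl hq)
      · exact this 0 _ _ (.inr hq)

theorem exists_free_option (op : ApprovalOp) (A : Finset (Fin m)) (a b : Fin m) :
    ∃ q ∈ options op (List.range m) (row A) a b, q.1 = 0 := by
  obtain ⟨q, hq, h, -⟩ := exists_option_of_ballotSteps (op := op) (c := 0) (a := a) (b := b)
    (show BallotSteps op 0 A A from rfl)
  exact ⟨q, hq, Nat.le_zero.1 h⟩

end

/-! ### Correctness of the dynamic program -/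

/-- The entries of the table are not too large: they are attained by a choice of options. Entries
that no choice attains would be `0`, which is why each list needs an option of cost `0`. -/
theorem exists_choice_of_mem_table {n : ℕ} (J : List ℕ) (V : Fin n → List (ℕ × ℕ))
    (hV : ∀ v, ∃ q ∈ V v, q.1 = 0) {p : ℕ × ℕ} (hp : p ∈ table J (List.ofFn V)) :
    ∃ q : Fin n → ℕ × ℕ, (∀ v, q v ∈ V v) ∧ ∑ v, (q v).1 ≤ p.1 ∧ p.2 ≤ ∑ v, (q v).2 := by
  induction n generalizing p with
  | zero =>
    obtain ⟨j, hj, rfl⟩ := List.mem_map.1 hp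
    exact ⟨fun v => (0, 0), fun v => v.elim0, by simp, by simp⟩
  | succ n ih =>
    choose f hf hf0 using hV
    have hzero : p.2 = 0 → ∃ q : Fin (n + 1) → ℕ × ℕ, (∀ v, q v ∈ V v) ∧ ∑ v, (q v).1 ≤ p.1 ∧
        p.2 ≤ ∑ v, (q v).2 := fun h => ⟨f, hf, by simp [hf0], h.le.trans (Nat.zero_le _)⟩
    rw [List.ofFn_succ] at hp
    obtain ⟨j, hj, rfl⟩ := List.mem_map.1 hp
    rcases maxOf_eq_zero_or_mem ((table J (List.ofFn fun i => V i.succ)).map fun p =>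
      maxOf ((V 0).map fun q => bif decide (p.1 + q.1 ≤ j) then p.2 + q.2 else 0)) with h0 | h0
    · exact hzero h0
    obtain ⟨p, hp', h1⟩ := List.mem_map.1 h0
    rcases maxOf_eq_zero_or_mem ((V 0).map fun q =>
      bif decide (p.1 + q.1 ≤ j) then p.2 + q.2 else 0) with h2 | h2
    · exact hzero (h1.symm.trans h2)
    obtain ⟨q0, hq0, h3⟩ := List.mem_map.1 h2
    have h4 := h3.trans h1
    obtain ⟨q, hq, hq1, hq2⟩ := ih (fun i => V i.succ) (fun i => ⟨f i.succ, hf _, hf0 _⟩) hp'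
    rw [Bool.cond_decide] at h4
    split_ifs at h4 with h5
    · refine ⟨Fin.cons q0 q, fun v => Fin.cases hq0 hq v, ?_, ?_⟩
      · rw [Fin.sum_univ_succ]
        simp only [Fin.cons_zero, Fin.cons_succ]
        omega
      · rw [Fin.sum_univ_succ]
        simp only [Fin.cons_zero, Fin.cons_succ]
        refine h4.symm.le.trans ?_
        omega
    · exact hzero h4.symm

/-- The entries of the table are large enough. -/
theorem exists_mem_table_of_choice {n : ℕ} (N : ℕ) (V : Fin n → List (ℕ × ℕ))
    (q : Fin n → ℕ × ℕ) (hq : ∀ v, q v ∈ V v) {j : ℕ} (hj : ∑ v, (q v).1 ≤ j) (hN : j < N) :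
    ∃ x, (j, x) ∈ table (List.range N) (List.ofFn V) ∧ ∑ v, (q v).2 ≤ x := by
  induction n generalizing j with
  | zero => exact ⟨0, List.mem_map.2 ⟨j, List.mem_range.2 hN, rfl⟩, by simp⟩
  | succ n ih =>
    rw [Fin.sum_univ_succ] at hj
    obtain ⟨x, hx, hx'⟩ := ih (fun i => V i.succ) (fun i => q i.succ) (fun i => hq i.succ)
      (j := ∑ i : Fin n, (q i.succ).1) le_rfl (by omega)
    rw [List.ofFn_succ]
    refine ⟨_, List.mem_map.2 ⟨j, List.mem_range.2 hN, rfl⟩, ?_⟩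
    refine le_trans ?_ (le_maxOf (List.mem_map.2 ⟨_, hx, rfl⟩))
    refine le_trans ?_ (le_maxOf (List.mem_map.2 ⟨_, hq 0, rfl⟩))
    rw [Fin.sum_univ_succ, Bool.cond_decide, if_pos (by dsimp only; omega)]
    dsimp only
    omega

/-! ### Correctness of the algorithm -/

section
variable {m n : ℕ}

theorem sum_value (E E' : Election m n) (a b : Fin m) :
    ∑ v, value (E v) (E' v) a b = m.factorial *
      (savCandidateScore E' a - savCandidateScore E' b + savCandidateScore E b) := by
  simp only [value, savCandidateScore_eq_sum_share, Finset.mul_sum, mul_add, mul_sub,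
    Finset.sum_add_distrib, Finset.sum_sub_distrib]

theorem length_flatten_electionRows (E : Election m n) :
    (electionRows E).flatten.length = n * m := by
  rw [List.length_flatten, electionRows, List.map_ofFn, List.sum_ofFn]
  simp [row]

/-- The test for a pair of candidates is correct. -/
theorem canOvertake_iff (op : ApprovalOp) (E : Election m n) (k B : ℕ) (hk : k ≤ m)
    (a b : Fin m) :
    canOvertake op (List.range m) k B (electionRows E) a b = true ↔
      (∃ S ∈ winners (savCandidateScore E) k, b ∈ S ∧ a ∉ S) ∧
      ∃ j ≤ B, ∃ E', op.Steps j E E' ∧ (savCandidateScore E' b < savCandidateScore E' a ∨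
        savCandidateScore E' b ≤ savCandidateScore E' a ∧
          savCandidateScore E a < savCandidateScore E b) := by
  have hfac : (0 : ℚ) < m.factorial := by positivity
  by_cases hab : a = b
  · subst hab
    simp [canOvertake]
  rw [exists_winner_iff (by simpa using hk) hab]
  have hab' : (a : ℕ) ≠ b := fun h => hab (Fin.ext h)
  have hmap : ((electionRows E).map fun r => options op (List.range m) r a b) =
      List.ofFn fun v => options op (List.range m) (row (E v)) a b := by
    rw [electionRows, List.map_ofFn]
    rfl
  simp only [canOvertake, hmap, length_filter_range, Bool.and_eq_true, Bool.or_eq_true,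
    Bool.not_eq_true', decide_eq_true_eq, decide_eq_false_iff_not, List.any_eq_true,
    List.length_cons, length_flatten_electionRows, intScore_lt_iff, hab', not_false_iff,
    true_and]
  have hle : ∀ c : Fin m, intScore (List.range m) (electionRows E) a ≤
      intScore (List.range m) (electionRows E) c ↔
      savCandidateScore E a ≤ savCandidateScore E c := fun c => by
    rw [← not_lt, intScore_lt_iff, not_lt]
  simp only [hle, and_assoc]
  refine and_congr_right fun _ => and_congr_right fun _ => ⟨?_, ?_⟩
  · rintro ⟨p, hp, hpB, hp2⟩
    obtain ⟨q, hq, hq1, hq2⟩ := exists_choice_of_mem_table _ _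
      (fun v => exists_free_option op (E v) a b) hp
    choose c hc E' hE' hval using fun v => exists_ballot_of_mem_options op (E v) hab (hq v)
    refine ⟨∑ v, c v, ((Finset.sum_le_sum fun v _ => hc v).trans hq1).trans hpB, E',
      steps_iff.2 ⟨c, rfl, hE'⟩, ?_⟩
    have h1 : (p.2 : ℚ) ≤ m.factorial * (savCandidateScore E' a - savCandidateScore E' b +
        savCandidateScore E b) := by
      rw [← sum_value]
      refine le_trans ?_ (Finset.sum_le_sum fun v _ => hval v)
      exact_mod_cast hq2
    rcases hp2 with h2 | ⟨h2, h3⟩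
    · left
      rw [← @Nat.cast_lt ℚ, intScore_eq] at h2
      have := lt_of_mul_lt_mul_left (h2.trans_le h1) hfac.le
      linarith
    · refine .inr ⟨?_, h3⟩
      rw [← @Nat.cast_le ℚ, intScore_eq] at h2
      have := le_of_mul_le_mul_left (h2.trans h1) hfac
      linarith
  · rintro ⟨j, hj, E', hE', h⟩
    obtain ⟨c, rfl, hc⟩ := steps_iff.1 hE'
    choose q hq hq1 hq2 using fun v => exists_option_of_ballotSteps (a := a) (b := b) (hc v)
    have hN : ∑ v, (q v).1 < n * m + 1 := by
      have := Finset.sum_le_sum fun v (_ : v ∈ Finset.univ) => cost_le_of_mem_options (hq v)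
      simp only [Finset.sum_const, Finset.card_univ, Fintype.card_fin, smul_eq_mul] at this
      omega
    obtain ⟨x, hx, hx2⟩ := exists_mem_table_of_choice _ _ q hq le_rfl hN
    refine ⟨_, hx, (Finset.sum_le_sum fun v _ => hq1 v).trans hj, ?_⟩
    have h1 : m.factorial * (savCandidateScore E' a - savCandidateScore E' b +
        savCandidateScore E b) ≤ (x : ℚ) := by
      rw [← sum_value]
      refine (Finset.sum_le_sum fun v _ => hq2 v).trans ?_
      exact_mod_cast hx2
    rcases h with h | ⟨h, h3⟩
    · left
      rw [← @Nat.cast_lt ℚ, intScore_eq]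
      refine lt_of_lt_of_le ?_ h1
      gcongr
      linarith
    · refine .inr ⟨?_, h3⟩
      rw [← @Nat.cast_le ℚ, intScore_eq]
      refine le_trans ?_ h1
      gcongr
      linarith

end

theorem isYes_iff (op : ApprovalOp) (I : RadiusInstance) :
    I.IsYes savRule op ↔ ∃ a b : Fin I.m, canOvertake op (List.range I.m) I.k I.bound
      (electionRows I.election) a b = true := by
  have hk : I.k ≤ Fintype.card (Fin I.m) := by simpa using I.k_le_m
  have hne : ∀ E' : Election I.m I.n, savRule I.m I.n I.election I.k ≠ savRule I.m I.n E' I.k ↔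
      _ := fun E' => winners_ne_iff (s := savCandidateScore I.election)
        (s' := savCandidateScore E') hk
  simp only [RadiusInstance.IsYes, hne, canOvertake_iff _ _ _ _ I.k_le_m]
  constructor
  · rintro ⟨j, hj, E', hE', a, b, hS, h⟩
    exact ⟨a, b, hS, j, hj, E', hE', h⟩
  · rintro ⟨a, b, hS, j, hj, E', hE', h⟩
    exact ⟨j, hj, E', hE', a, b, hS, h⟩

/-! ### Decoding -/

theorem foldl_blockStep_bitBlock (l cur : List Bool) (bs : List (List Bool)) :
    (bitBlock l).foldl blockStep (bs, cur) = ((cur.reverse ++ l) :: bs, []) := by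
  induction l generalizing cur with
  | nil => simp [bitBlock, blockStep]
  | cons x l ih =>
    have : bitBlock (x :: l) = some x :: bitBlock l := rfl
    rw [this, List.foldl_cons]
    simp only [blockStep, Option.isNone_some, cond_false, Option.getD_some]
    rw [ih]
    simp

theorem blocks_flatten (bs : List (List Bool)) :
    blocks (bs.map bitBlock).flatten = (bs.reverse, []) := by
  have : ∀ (bs cs : List (List Bool)), (bs.map bitBlock).flatten.foldl blockStep (cs, []) =
      (bs.reverse ++ cs, []) := by
    intro bs
    induction bs with
    | nil => simp
    | cons l bs ih =>
      intro cs
      rw [List.map_cons, List.flatten_cons, List.foldl_append, foldl_blockStep_bitBlock, ih]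
      simp
  simpa [blocks] using this bs []

/-- The division into blocks loses no information. -/
theorem eq_flatten_blocks (w : List (Option Bool)) :
    w = ((blocks w).1.reverse.map bitBlock).flatten ++ (blocks w).2.reverse.map some := by
  induction w using List.reverseRecOn with
  | nil => rfl
  | append_singleton w x ih =>
    have : blocks (w ++ [x]) = blockStep (blocks w) x := by simp [blocks, List.foldl_append]
    rw [this]
    conv_lhs => rw [ih]
    cases x <;> simp [blockStep, bitBlock]

theorem ofBits_bits (n : ℕ) : ofBits n.bits = n := by
  induction n using Nat.binaryRec' with
  | zero => rfl
  | bit b n hb ih =>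
    rw [Nat.bits_append_bit _ _ hb]
    have : ofBits (b :: n.bits) = ofBits n.bits + ofBits n.bits + b.toNat := rfl
    rw [this, ih]
    cases b <;> simp [Nat.bit] <;> omega

/-- The highest bit of a number, if there is any, is `1`. -/
theorem foldl_last_bits (n : ℕ) : n.bits.foldl (fun _ x => x) true = true := by
  induction n using Nat.binaryRec' with
  | zero => rfl
  | bit b n hb ih =>
    rw [Nat.bits_append_bit _ _ hb, List.foldl_cons]
    rcases Nat.eq_zero_or_pos n with rfl | hn
    · simp [hb rfl]
    · rcases hl : n.bits with _ | ⟨x, l⟩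
      · have := ofBits_bits n
        rw [hl] at this
        exact absurd this hn.ne
      · rwa [hl] at ih

/-- A list of bits is the binary code of a number if it does not end with the bit `0`. -/
theorem bits_ofBits {l : List Bool} (h : l.foldl (fun _ x => x) true = true) :
    (ofBits l).bits = l := by
  induction l with
  | nil => exact Nat.zero_bits
  | cons b l ih =>
    have hcons : ofBits (b :: l) = ofBits l + ofBits l + b.toNat := rfl
    rcases l with _ | ⟨x, l⟩
    · have hb : b = true := h
      subst hb
      exact Nat.one_bits
    · have ih' := ih h
      have hpos : 0 < ofBits (x :: l) := by
        rw [Nat.pos_iff_ne_zero]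
        intro h0
        rw [h0, Nat.zero_bits] at ih'
        cases ih'
      rw [bits_of_eq (b := b) (k := ofBits (x :: l)) (by omega) (by omega), ih']

/-- The blocks of the code of an instance. -/
theorem encode_eq_flatten (I : RadiusInstance) : I.encode =
    ((List.replicate I.m true :: I.k.bits :: I.bound.bits :: electionRows I.election).map
      bitBlock).flatten := by
  simp [RadiusInstance.encode, electionRows, List.map_ofFn, Function.comp_def, row]

theorem decideWord_encode (op : ApprovalOp) (I : RadiusInstance) :
    decideWord op I.encode = true ↔ I.IsYes savRule op := by
  rw [isYes_iff, encode_eq_flatten, decideWord, blocks_flatten]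
  have hrows : ∀ r ∈ electionRows I.election, r.length = I.m := by
    intro r hr
    obtain ⟨v, rfl⟩ := List.mem_ofFn.1 hr
    simp [row]
  simp [decideBlocks, foldl_last_bits, ofBits_bits, I.one_le_k, I.k_le_m,
    Fin.exists_iff]
  exact fun _ _ _ _ _ => hrows

/-- A word that passes the syntactic tests of the algorithm is the code of an instance. -/
theorem exists_encode_eq {op : ApprovalOp} {w : List (Option Bool)}
    (h : decideWord op w = true) : ∃ I : RadiusInstance, I.encode = w := by
  simp only [decideWord, Bool.and_eq_true, decide_eq_true_eq, List.isEmpty_iff] at h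
  obtain ⟨⟨h1, h2⟩, h3⟩ := h
  have hw := eq_flatten_blocks w
  rw [← List.length_reverse] at h2
  rw [h1] at hw
  rcases hL : (blocks w).1.reverse with _ | ⟨us, _ | ⟨kb, _ | ⟨Bb, rows⟩⟩⟩
  iterate 3
    rw [hL] at h2
    simp at h2
  rw [hL] at hw h3
  simp only [List.headD_cons, List.tail_cons, decideBlocks, Bool.and_eq_true, List.all_eq_true] at h3
  obtain ⟨⟨⟨⟨⟨⟨hus, hkb⟩, hBb⟩, hrows⟩, hk1⟩, hk2⟩, -⟩ := h3
  refine ⟨⟨us.length, rows.length, fun v => Finset.univ.filter fun c =>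
    (rows[v]).getD c false = true, ofBits kb, ofBits Bb, of_decide_eq_true hk1,
    of_decide_eq_true hk2⟩, ?_⟩
  rw [encode_eq_flatten, hw]
  have h4 : List.replicate us.length true = us := (List.eq_replicate_of_mem hus).symm
  have h5 : electionRows (fun v : Fin rows.length => Finset.univ.filter fun c : Fin us.length =>
      (rows[v]).getD c false = true) = rows := by
    apply List.ext_getElem
    · simp [electionRows]
    · intro i hi hi'
      simp only [electionRows, List.getElem_ofFn]
      apply List.ext_getElem
      · simpa [row] using (of_decide_eq_true (hrows _ (List.getElem_mem hi'))).symm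
      · intro c hc hc'
        simp [row, List.getD_eq_getElem?_getD, hc']
  simp only [bits_ofBits hkb, bits_ofBits hBb, h4, h5]
  simp

end SavRobustness

theorem mainTheorem7 (op : ApprovalOp) : InP (robustnessRadius savRule op) := by
  refine SavRobustness.inP_of_polyTime (SavRobustness.PolyTime.decideWord op) fun w => ?_
  constructor
  · intro h
    obtain ⟨I, rfl⟩ := SavRobustness.exists_encode_eq h
    exact ⟨I, rfl, (SavRobustness.decideWord_encode op I).1 h⟩
  · rintro ⟨I, rfl, hI⟩
    exact (SavRobustness.decideWord_encode op I).2 hI
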